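/- Let $n\ge 1$ and let $F_n$ be the free Heyting algebra on $n$ generators $g_1,\dots,g_n$, i.e. the intuitionistic propositional formulae in the variables $P_1,\dots,P_n$ modulo intuitionistic equivalence. Let $(K_n,\le)$ be the following partially ordered set with valuation $\mathrm{val}:K_n\to\mathcal P(\{P_1,\dots,P_n\})$. Put $K_n^{-1}=\emptyset$; $K_n=\bigcup_{d\ge 0}K_n^d$, where $K_n^d\setminus K_n^{d-1}$ consists of all formal points $w_{\beta,Y}$ such that $Y$ is a decreasing subset of $K_n^{d-1}$ with $Y\not\subseteq K_n^{d-2}$ (for $d=0$ this last condition is dropped, so $Y=\emptyset$), $\beta\subseteq\{P_1,\dots,P_n\}$ satisfies $\beta\subseteq\mathrm{val}(w')$ for all $w'\in Y$, and $\beta\ne\mathrm{val}(v)$ whenever $Y$ is the decreasing set generated by a single point $v$. Here $\mathrm{val}(w_{\beta,Y})=\beta$, and $w\le w_{\beta,Y}$ iff $w\in Y$ or $w=w_{\beta,Y}$. Let $\widehat F_n$ be the Heyting algebra of decreasing subsets of $K_n$, with the metric $d(a,b)=2^{-\min\{i\,\mid\, a\cap K_n^i\ne b\cap K_n^i\}}$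 for $a\neq b$ (and $d(a,a)=0$); a Heyting subalgebra $H$ of $\widehat F_n$ is called dense if it is dense for this metric. Write $[\![\cdot]\!]:F_n\to\widehat F_n$ for the Heyting homomorphism with $[\![g_i]\!]=\{w\in K_n\mid P_i\in\mathrm{val}(w)\}$, and let $\breve F_n\subseteq\widehat F_n$ be the image under $[\![\cdot]\!]$ of the Heyting subalgebra of $F_n$ generated by all completely join-irreducible elements of $F_n$ (those that are not the join of any, possibly infinite or empty, set of other elements). Finally put $a_i=\{w_{\{P_i\},\emptyset}\}\in\widehat F_n$. Automorphisms are automorphisms of Heyting algebras. Then: 1. $\{g_1,\dots,g_n\}$ is the only set of free generators of $F_n$ (among sets of any cardinality). Hence $\mathrm{Aut}(F_n)=\mathrm{Sym}(n)$: there is a group isomorphism $\mathrm{Aut}(F_n)\to\mathrm{Sym}(n)$, $\alpha\mapsto\sigma_\alpha$, with $\alpha(g_i)=g_{\sigma_\alpha(i)}$ for all $i$ and $\alpha$. 2. Let $H$ be a dense Heyting subalgebra of $\widehat F_n$. Then $\mathrm{Aut}(H)\le\mathrm{Sym}(n)$: the elements $a_1,\dots,a_n$ lie in $H$, and there is an injective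 group homomorphism $\rho:\mathrm{Aut}(H)\to\mathrm{Sym}(n)$ with $\alpha(a_i)=a_{\rho(\alpha)(i)}$ for all $i$ and $\alpha$. If $H$ is in addition setwise invariant under $\mathrm{Aut}(\widehat F_n)$, then $\rho$ is surjective, i.e. $\mathrm{Aut}(H)=\mathrm{Sym}(n)$. 3. Both $\widehat F_n$ and $\breve F_n$ are dense in $\widehat F_n$ and setwise invariant under $\mathrm{Aut}(\widehat F_n)$, so that 2. applies to them with equality. -/

import Mathlib

universe u

/-! ### Heyting subalgebras -/

/-- A Heyting subalgebra: a subset closed under `0, 1, ⊓, ⊔, →`. -/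
structure HeytingSubalgebra (A : Type*) [HeytingAlgebra A] where
  carrier : Set A
  bot_mem' : ⊥ ∈ carrier
  top_mem' : ⊤ ∈ carrier
  inf_mem' : ∀ {a b}, a ∈ carrier → b ∈ carrier → a ⊓ b ∈ carrier
  sup_mem' : ∀ {a b}, a ∈ carrier → b ∈ carrier → a ⊔ b ∈ carrier
  himp_mem' : ∀ {a b}, a ∈ carrier → b ∈ carrier → a ⇨ b ∈ carrier

namespace HeytingSubalgebra

variable {A B : Type*} [HeytingAlgebra A] [HeytingAlgebra B]

instance : SetLike (HeytingSubalgebra A) A where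
  coe L := L.carrier
  coe_injective L M h := by cases L; cases M; congr

/-- The order on a Heyting subalgebra is the restricted one, and so are the operations. -/
instance (L : HeytingSubalgebra A) : HeytingAlgebra L where
  le a b := (a : A) ≤ b
  lt a b := (a : A) < b
  le_refl a := le_refl (a : A)
  le_trans a b c := le_trans (a := (a : A))
  lt_iff_le_not_ge a b := lt_iff_le_not_ge (a := (a : A))
  le_antisymm a b h h' := Subtype.ext (le_antisymm h h')
  sup a b := ⟨a ⊔ b, L.sup_mem' a.2 b.2⟩
  le_sup_left a b := le_sup_left (a := (a : A))
  le_sup_right a b := le_sup_right (a := (a : A))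
  sup_le a b c := sup_le (a := (a : A))
  inf a b := ⟨a ⊓ b, L.inf_mem' a.2 b.2⟩
  inf_le_left a b := inf_le_left (a := (a : A))
  inf_le_right a b := inf_le_right (a := (a : A))
  le_inf a b c h h' := le_inf (α := A) h h'
  top := ⟨⊤, L.top_mem'⟩
  le_top a := le_top (a := (a : A))
  himp a b := ⟨a ⇨ b, L.himp_mem' a.2 b.2⟩
  le_himp_iff a b c := le_himp_iff (a := (a : A))
  bot := ⟨⊥, L.bot_mem'⟩
  bot_le a := bot_le (a := (a : A))
  compl a := ⟨a ⇨ ⊥, L.himp_mem' a.2 L.bot_mem'⟩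
  himp_bot a := rfl

/-- The whole algebra. -/
instance : Top (HeytingSubalgebra A) where
  top := ⟨Set.univ, trivial, trivial, fun _ _ => trivial, fun _ _ => trivial, fun _ _ => trivial⟩

/-- The Heyting subalgebra generated by a set. -/
def closure (S : Set A) : HeytingSubalgebra A where
  carrier := {x | ∀ L : HeytingSubalgebra A, S ⊆ (L : Set A) → x ∈ L}
  bot_mem' L _ := L.bot_mem'
  top_mem' L _ := L.top_mem'
  inf_mem' ha hb L h := L.inf_mem' (ha L h) (hb L h)
  sup_mem' ha hb L h := L.sup_mem' (ha L h) (hb L h)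
  himp_mem' ha hb L h := L.himp_mem' (ha L h) (hb L h)

/-- The image of a Heyting subalgebra under a homomorphism. -/
def map (f : HeytingHom A B) (L : HeytingSubalgebra A) : HeytingSubalgebra B where
  carrier := f '' (L : Set A)
  bot_mem' := ⟨⊥, L.bot_mem', map_bot f⟩
  top_mem' := ⟨⊤, L.top_mem', map_top f⟩
  inf_mem' := by
    rintro _ _ ⟨a, ha, rfl⟩ ⟨b, hb, rfl⟩
    exact ⟨a ⊓ b, L.inf_mem' ha hb, map_inf f a b⟩
  sup_mem' := by
    rintro _ _ ⟨a, ha, rfl⟩ ⟨b, hb, rfl⟩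
    exact ⟨a ⊔ b, L.sup_mem' ha hb, map_sup f a b⟩
  himp_mem' := by
    rintro _ _ ⟨a, ha, rfl⟩ ⟨b, hb, rfl⟩
    exact ⟨a ⇨ b, L.himp_mem' ha hb, map_himp f a b⟩

end HeytingSubalgebra

/-- The automorphism group of a Heyting algebra. All operations of a Heyting algebra are
determined by its order, so the automorphisms are the order automorphisms (Mathlib's
`OrderIsoClass.toHeytingHomClass`); the multiplication is composition. -/
abbrev HeytingAut (A : Type*) [HeytingAlgebra A] := A ≃o A

/-- A completely join-irreducible element: whenever `a` is the join of a set of elements (possibly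
infinite, possibly empty), `a` is one of them. -/
def CompletelyJoinIrreducible {A : Type*} [HeytingAlgebra A] (a : A) : Prop :=
  ∀ S : Set A, IsLUB S a → a ∈ S

/-! ### Free Heyting algebras

The free Heyting algebra over `α` is the algebra of intuitionistic propositional formulae in the
variables `α`, ordered by intuitionistic entailment, modulo equivalence. -/

/-- Intuitionistic propositional formulae with variables in `α`. -/
inductive IForm (α : Type*) where
  | var (a : α) : IForm α
  | bot : IForm α
  | top : IForm α
  | and (p q : IForm α) : IForm α
  | or (p q : IForm α) : IForm α
  | imp (p q : IForm α) : IForm α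

namespace IForm

variable {α : Type*} {A : Type*} [HeytingAlgebra A]

/-- Intuitionistic entailment `p ⊢ q`. -/
inductive Entails : IForm α → IForm α → Prop
  | refl (p) : Entails p p
  | trans {p q r} : Entails p q → Entails q r → Entails p r
  | bot_le (p) : Entails bot p
  | le_top (p) : Entails p top
  | and_left (p q) : Entails (and p q) p
  | and_right (p q) : Entails (and p q) q
  | le_and {p q r} : Entails p q → Entails p r → Entails p (and q r)
  | or_left (p q) : Entails p (or p q)
  | or_right (p q) : Entails q (or p q)
  | or_le {p q r} : Entails p r → Entails q r → Entails (or p q) r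
  | le_imp {p q r} : Entails (and p q) r → Entails p (imp q r)
  | of_le_imp {p q r} : Entails p (imp q r) → Entails (and p q) r

/-- The value of a formula in a Heyting algebra under an assignment of the variables. -/
def eval (f : α → A) : IForm α → A
  | var a => f a
  | bot => ⊥
  | top => ⊤
  | and p q => eval f p ⊓ eval f q
  | or p q => eval f p ⊔ eval f q
  | imp p q => eval f p ⇨ eval f q

theorem Entails.eval_le (f : α → A) {p q : IForm α} (h : Entails p q) : eval f p ≤ eval f q := by
  induction h with
  | refl p => exact le_refl _
  | trans _ _ h₁ h₂ => exact h₁.trans h₂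
  | bot_le p => exact _root_.bot_le
  | le_top p => exact _root_.le_top
  | and_left p q => exact inf_le_left
  | and_right p q => exact inf_le_right
  | le_and _ _ h₁ h₂ => exact le_inf h₁ h₂
  | or_left p q => exact le_sup_left
  | or_right p q => exact le_sup_right
  | or_le _ _ h₁ h₂ => exact sup_le h₁ h₂
  | le_imp _ h => exact le_himp_iff.2 h
  | of_le_imp _ h => exact le_himp_iff.1 h

/-- Intuitionistic equivalence of formulae. -/
instance setoid (α : Type*) : Setoid (IForm α) where
  r p q := Entails p q ∧ Entails q p
  iseqv :=
    ⟨fun p => ⟨.refl p, .refl p⟩, fun h => ⟨h.2, h.1⟩,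
      fun h h' => ⟨h.1.trans h'.1, h'.2.trans h.2⟩⟩

end IForm

/-- The free Heyting algebra over `α`. -/
def FreeHeyting (α : Type*) : Type _ := Quotient (IForm.setoid α)

namespace FreeHeyting

open IForm

variable {α : Type*} {A : Type*} [HeytingAlgebra A]

/-- The implication of the free Heyting algebra. -/
protected def himp : FreeHeyting α → FreeHeyting α → FreeHeyting α :=
  Quotient.map₂ IForm.imp fun _ _ h _ _ h' =>
    ⟨.le_imp (Entails.trans (.le_and (.and_left _ _) ((Entails.and_right _ _).trans h.2))
        ((Entails.of_le_imp (.refl _)).trans h'.1)),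
      .le_imp (Entails.trans (.le_and (.and_left _ _) ((Entails.and_right _ _).trans h.1))
        ((Entails.of_le_imp (.refl _)).trans h'.2))⟩

instance : HeytingAlgebra (FreeHeyting α) where
  le := Quotient.lift₂ Entails fun _ _ _ _ h h' => propext
    ⟨fun k => h.2.trans (k.trans h'.1), fun k => h.1.trans (k.trans h'.2)⟩
  le_refl := by rintro ⟨p⟩; exact .refl p
  le_trans := by rintro ⟨p⟩ ⟨q⟩ ⟨r⟩ h h'; exact Entails.trans h h'
  le_antisymm := by rintro ⟨p⟩ ⟨q⟩ h h'; exact Quotient.sound ⟨h, h'⟩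
  sup := Quotient.map₂ IForm.or fun _ _ h _ _ h' =>
    ⟨.or_le (h.1.trans (.or_left _ _)) (h'.1.trans (.or_right _ _)),
      .or_le (h.2.trans (.or_left _ _)) (h'.2.trans (.or_right _ _))⟩
  le_sup_left := by rintro ⟨p⟩ ⟨q⟩; exact .or_left p q
  le_sup_right := by rintro ⟨p⟩ ⟨q⟩; exact .or_right p q
  sup_le := by rintro ⟨p⟩ ⟨q⟩ ⟨r⟩ h h'; exact Entails.or_le h h'
  inf := Quotient.map₂ IForm.and fun _ _ h _ _ h' =>
    ⟨.le_and ((Entails.and_left _ _).trans h.1) ((Entails.and_right _ _).trans h'.1),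
      .le_and ((Entails.and_left _ _).trans h.2) ((Entails.and_right _ _).trans h'.2)⟩
  inf_le_left := by rintro ⟨p⟩ ⟨q⟩; exact .and_left p q
  inf_le_right := by rintro ⟨p⟩ ⟨q⟩; exact .and_right p q
  le_inf := by rintro ⟨p⟩ ⟨q⟩ ⟨r⟩ h h'; exact Entails.le_and h h'
  top := Quotient.mk _ IForm.top
  le_top := by rintro ⟨p⟩; exact .le_top p
  himp := FreeHeyting.himp
  le_himp_iff := by rintro ⟨p⟩ ⟨q⟩ ⟨r⟩; exact ⟨Entails.of_le_imp, Entails.le_imp⟩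
  bot := Quotient.mk _ IForm.bot
  bot_le := by rintro ⟨p⟩; exact .bot_le p
  compl := fun x => FreeHeyting.himp x (Quotient.mk _ IForm.bot)
  himp_bot _ := rfl

/-- The class of a variable: the standard free generators. -/
def gen (a : α) : FreeHeyting α := Quotient.mk _ (var a)

/-- The homomorphism from the free Heyting algebra extending a map on the generators. -/
def lift (f : α → A) : HeytingHom (FreeHeyting α) A where
  toFun := Quotient.lift (eval f) fun _ _ h => le_antisymm (h.1.eval_le f) (h.2.eval_le f)
  map_sup' := by rintro ⟨p⟩ ⟨q⟩; rfl
  map_inf' := by rintro ⟨p⟩ ⟨q⟩; rfl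
  map_bot' := rfl
  map_himp' := by rintro ⟨p⟩ ⟨q⟩; rfl

theorem lift_gen (f : α → A) (a : α) : lift f (gen a) = f a := rfl

theorem hom_ext {f g : HeytingHom (FreeHeyting α) A} (h : ∀ a, f (gen a) = g (gen a)) :
    f = g := by
  refine HeytingHom.ext ?_
  rintro ⟨p⟩
  change f (Quotient.mk _ p) = g (Quotient.mk _ p)
  induction p with
  | var a => exact h a
  | bot => exact (map_bot f).trans (map_bot g).symm
  | top => exact (map_top f).trans (map_top g).symm
  | and p q hp hq => exact (map_inf f _ _).trans ((congrArg₂ _ hp hq).trans (map_inf g _ _).symm)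
  | or p q hp hq => exact (map_sup f _ _).trans ((congrArg₂ _ hp hq).trans (map_sup g _ _).symm)
  | imp p q hp hq =>
    exact (map_himp f _ _).trans ((congrArg₂ _ hp hq).trans (map_himp g _ _).symm)

end FreeHeyting

/-- `S` is a set of free generators of `A`: the canonical homomorphism from the free Heyting
algebra over `S` to `A` is bijective, i.e. every element of `A` is a term in elements of `S`, and
the only relations between the elements of `S` are the laws of Heyting algebras. -/
def IsFreeGeneratingSet {A : Type*} [HeytingAlgebra A] (S : Set A) : Prop :=
  Function.Bijective (FreeHeyting.lift (Subtype.val : S → A))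

/-- Sets of free generators are exactly the sets with the universal property. -/
theorem isFreeGeneratingSet_iff {A : Type u} [HeytingAlgebra A] (S : Set A) :
    IsFreeGeneratingSet S ↔
      ∀ (B : Type u) [HeytingAlgebra B] (f : S → B), ∃! g : HeytingHom A B, ∀ s : S, g s = f s := by
  constructor
  · intro h B _ f
    have hinv : ∀ a, ∃ x, FreeHeyting.lift (Subtype.val : S → A) x = a := h.2
    choose k hk using hinv
    have hk' : ∀ x, k (FreeHeyting.lift (Subtype.val : S → A) x) = x := fun x => h.1 (hk _)
    refine ⟨{ toFun := fun a => FreeHeyting.lift f (k a)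
              map_sup' := fun a b => ?_
              map_inf' := fun a b => ?_
              map_bot' := ?_
              map_himp' := fun a b => ?_ }, fun s => ?_, fun g hg => HeytingHom.ext fun a => ?_⟩
    · rw [← map_sup]
      exact congrArg _ (h.1 (by rw [hk, map_sup, hk, hk]))
    · change FreeHeyting.lift f (k (a ⊓ b)) = FreeHeyting.lift f (k a) ⊓ FreeHeyting.lift f (k b)
      rw [← map_inf]
      exact congrArg _ (h.1 (by rw [hk, map_inf, hk, hk]))
    · change FreeHeyting.lift f (k ⊥) = ⊥
      rw [← map_bot (FreeHeyting.lift f)]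
      exact congrArg _ (h.1 (by rw [hk, map_bot]))
    · rw [← map_himp]
      exact congrArg _ (h.1 (by rw [hk, map_himp, hk, hk]))
    · change FreeHeyting.lift f (k s) = f s
      rw [← FreeHeyting.lift_gen (Subtype.val : S → A) s, hk', FreeHeyting.lift_gen]
    · change g a = FreeHeyting.lift f (k a)
      have : g.comp (FreeHeyting.lift (Subtype.val : S → A)) = FreeHeyting.lift f :=
        FreeHeyting.hom_ext fun s => hg s
      rw [← this, HeytingHom.comp_apply, hk]
  · intro h
    obtain ⟨g, hg, -⟩ := h (FreeHeyting S) FreeHeyting.gen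
    have h₁ : g.comp (FreeHeyting.lift (Subtype.val : S → A)) = HeytingHom.id _ :=
      FreeHeyting.hom_ext fun s => hg s
    have h₂ : (FreeHeyting.lift (Subtype.val : S → A)).comp g = HeytingHom.id _ :=
      (h A Subtype.val).unique (fun s => by rw [HeytingHom.comp_apply, hg]; rfl) (fun s => rfl)
    refine ⟨fun x y hxy => ?_, fun a => ⟨g a, DFunLike.congr_fun h₂ a⟩⟩
    have := congrArg g hxy
    exact (DFunLike.congr_fun h₁ x).symm.trans (this.trans (DFunLike.congr_fun h₁ y))

/-! ### The generic Kripke model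

The valuations are the subsets `β` of the set `{P_i | i : Fin n}` of variables. The formal symbol
`w_{β,Y}`, where `Y` is a finite set of earlier symbols, is represented by a natural number that
encodes the pair `(β, Y)`. -/

namespace Bellissima

/-- The symbol `w_{β,Y}`. -/
def code {n : ℕ} (β : Finset (Fin n)) (Y : Finset ℕ) : ℕ := Encodable.encode (β, Y)

/-- The valuation `β` of `w_{β,Y}`. -/
def codeVal (n : ℕ) (w : ℕ) : Finset (Fin n) :=
  ((Encodable.decode w : Option (Finset (Fin n) × Finset ℕ)).getD (∅, ∅)).1

/-- The set `Y` of the points strictly below `w_{β,Y}`. -/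
def codeBelow (n : ℕ) (w : ℕ) : Finset ℕ :=
  ((Encodable.decode w : Option (Finset (Fin n) × Finset ℕ)).getD (∅, ∅)).2

@[simp] theorem codeVal_code {n : ℕ} (β : Finset (Fin n)) (Y : Finset ℕ) :
    codeVal n (code β Y) = β := by simp [codeVal, code]

@[simp] theorem codeBelow_code {n : ℕ} (β : Finset (Fin n)) (Y : Finset ℕ) :
    codeBelow n (code β Y) = Y := by simp [codeBelow, code]

/-- `level n (d + 1)` is the set `K_n^d`, and `level n 0` is `K_n^{-1} = ∅`. The points of
`K_n^{d+1}` that are not in `K_n^d` are the symbols `w_{β,Y}` such that `Y ⊆ K_n^d` is decreasing,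
`Y ⊄ K_n^{d-1}`, `β` is contained in the valuations of all points of `Y`, and `β` differs from the
valuation of `v` if `Y` is the decreasing set generated by a point `v`. -/
def level (n : ℕ) : ℕ → Set ℕ
  | 0 => ∅
  | 1 => {w | ∃ β : Finset (Fin n), w = code β ∅}
  | d + 2 => level n (d + 1) ∪
      {w | ∃ (β : Finset (Fin n)) (Y : Finset ℕ), w = code β Y ∧
        (Y : Set ℕ) ⊆ level n (d + 1) ∧
        (∀ v ∈ Y, codeBelow n v ⊆ Y) ∧
        ¬ (Y : Set ℕ) ⊆ level n d ∧
        (∀ v ∈ Y, β ⊆ codeVal n v) ∧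
        (∀ v ∈ Y, Y = insert v (codeBelow n v) → β ≠ codeVal n v)}

theorem level_mono_succ (n d : ℕ) : level n d ⊆ level n (d + 1) := by
  cases d with
  | zero => exact Set.empty_subset _
  | succ d => exact Set.subset_union_left

theorem level_spec {n : ℕ} : ∀ {d w : ℕ}, w ∈ level n (d + 1) →
    (codeBelow n w : Set ℕ) ⊆ level n d ∧
      (∀ v ∈ codeBelow n w, codeBelow n v ⊆ codeBelow n w) ∧
      (∀ v ∈ codeBelow n w, codeVal n w ⊆ codeVal n v)
  | 0, w, h => by
    obtain ⟨β, rfl⟩ := h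
    simp
  | d + 1, w, h => by
    rcases h with h | ⟨β, Y, rfl, h₁, h₂, -, h₃, -⟩
    · have := level_spec h
      exact ⟨this.1.trans (level_mono_succ n d), this.2⟩
    · simpa using ⟨h₁, h₂, h₃⟩

theorem not_mem_codeBelow {n : ℕ} : ∀ {d w : ℕ}, w ∈ level n d → w ∉ codeBelow n w
  | 0, _, h, _ => h
  | _ + 1, _, h, h' => not_mem_codeBelow ((level_spec h).1 h') h'

/-- The set `K_n` of points of the generic Kripke model, the union of all `K_n^d`. -/
def K (n : ℕ) : Type := {w : ℕ // ∃ d, w ∈ level n d}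

theorem spec {n : ℕ} (w : K n) :
    (∀ v ∈ codeBelow n w.1, codeBelow n v ⊆ codeBelow n w.1) ∧
      (∀ v ∈ codeBelow n w.1, codeVal n w.1 ⊆ codeVal n v) := by
  obtain ⟨w, d, h⟩ := w
  exact (level_spec (level_mono_succ n d h)).2

/-- `v ≤ w_{β,Y}` if and only if `v ∈ Y` or `v = w_{β,Y}`. -/
instance (n : ℕ) : PartialOrder (K n) where
  le v w := v.1 ∈ codeBelow n w.1 ∨ v = w
  le_refl w := Or.inr rfl
  le_trans u v w := by
    rintro (h | rfl) (h' | rfl)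
    · exact Or.inl ((spec w).1 _ h' h)
    · exact Or.inl h
    · exact Or.inl h'
    · exact Or.inr rfl
  le_antisymm v w := by
    rintro (h | rfl) (h' | h')
    · exact absurd ((spec v).1 _ h' h) (by obtain ⟨d, hd⟩ := v.2; exact not_mem_codeBelow hd)
    · exact h'.symm
    · rfl
    · rfl

/-- The valuation of a point. -/
def K.val {n : ℕ} (w : K n) : Finset (Fin n) := codeVal n w.1

/-- The set `K_n^d`, as a set of points of `K_n`. -/
def Klevel (n d : ℕ) : Set (K n) := {w | w.1 ∈ level n (d + 1)}

/-- The Heyting algebra of decreasing subsets of `K_n`, ordered by inclusion. -/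
abbrev Fhat (n : ℕ) : Type := LowerSet (K n)

theorem exists_level_ne {n : ℕ} {a b : Fhat n} (h : a ≠ b) :
    ∃ i, (a : Set (K n)) ∩ Klevel n i ≠ (b : Set (K n)) ∩ Klevel n i := by
  by_contra! H
  refine h (SetLike.ext fun w => ?_)
  obtain ⟨d, hd⟩ := w.2
  have hw : w ∈ Klevel n d := level_mono_succ n d hd
  have := Set.ext_iff.1 (H d) w
  simpa [hw] using this

open Classical in
/-- `d(a,b) = 2^{-min {i | a ∩ K_n^i ≠ b ∩ K_n^i}}`, and `d(a,b) = 0` if there is no such `i`. -/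
noncomputable def FhatDist {n : ℕ} (a b : Fhat n) : ℝ :=
  if h : ∃ i, (a : Set (K n)) ∩ Klevel n i ≠ (b : Set (K n)) ∩ Klevel n i
  then (2 : ℝ)⁻¹ ^ Nat.find h else 0

noncomputable instance (n : ℕ) : MetricSpace (Fhat n) where
  dist := FhatDist
  dist_self a := by simp [FhatDist]
  dist_comm a b := by
    unfold FhatDist
    split_ifs with h h' h'
    · exact congrArg _ (Nat.find_congr' (fun {_} => ne_comm))
    · exact absurd (h.imp fun _ => Ne.symm) h'
    · exact absurd (h'.imp fun _ => Ne.symm) h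
    · rfl
  dist_triangle a b c := by
    classical
    have nn : ∀ x y : Fhat n, 0 ≤ FhatDist x y := fun x y => by
      unfold FhatDist; split_ifs <;> positivity
    have key : ∀ (x y : Fhat n) (i : ℕ),
        (x : Set (K n)) ∩ Klevel n i ≠ (y : Set (K n)) ∩ Klevel n i →
        (2 : ℝ)⁻¹ ^ i ≤ FhatDist x y := fun x y i hi => by
      have hex : ∃ i, (x : Set (K n)) ∩ Klevel n i ≠ (y : Set (K n)) ∩ Klevel n i := ⟨i, hi⟩
      rw [FhatDist, dif_pos hex]
      exact pow_le_pow_of_le_one (by norm_num) (by norm_num) (Nat.find_min' hex hi)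
    by_cases h : ∃ i, (a : Set (K n)) ∩ Klevel n i ≠ (c : Set (K n)) ∩ Klevel n i
    · have hac : FhatDist a c = (2 : ℝ)⁻¹ ^ Nat.find h := dif_pos h
      have hs := Nat.find_spec h
      rw [hac]
      by_cases hab : (a : Set (K n)) ∩ Klevel n (Nat.find h) = (b : Set (K n)) ∩ Klevel n (Nat.find h)
      · exact (key b c _ (hab ▸ hs)).trans (le_add_of_nonneg_left (nn a b))
      · exact (key a b _ hab).trans (le_add_of_nonneg_right (nn b c))
    · have hac : FhatDist a c = 0 := dif_neg h
      rw [hac]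
      exact add_nonneg (nn a b) (nn b c)
  eq_of_dist_eq_zero {a b} h := by
    by_contra hab
    have := exists_level_ne hab
    change FhatDist a b = 0 at h
    rw [FhatDist, dif_pos this] at h
    exact absurd h (by positivity)

/-- `[[P_i]]`, the set of points at which the variable `P_i` holds. -/
def P {n : ℕ} (i : Fin n) : Fhat n where
  carrier := {w | i ∈ w.val}
  lower' := by
    rintro w v (h | rfl) hw
    · exact (spec w).2 _ h hw
    · exact hw

/-- The homomorphism `φ ↦ [[φ]]` from the free Heyting algebra to the decreasing subsets of
`K_n`. -/
noncomputable def sem (n : ℕ) : HeytingHom (FreeHeyting (Fin n)) (Fhat n) := FreeHeyting.lift P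

/-- The algebra generated by all completely join-irreducible elements of the free Heyting
algebra, as a subalgebra of the algebra of decreasing subsets of `K_n`. -/
noncomputable def Fkl (n : ℕ) : HeytingSubalgebra (Fhat n) :=
  (HeytingSubalgebra.closure {a : FreeHeyting (Fin n) | CompletelyJoinIrreducible a}).map (sem n)

/-- The point `w_{{P_i},∅}`. -/
def atomPoint {n : ℕ} (i : Fin n) : K n := ⟨code {i} ∅, 1, {i}, rfl⟩

/-- The pre-generator `a_i`: the atom `{w_{{P_i},∅}}`. -/
def preGen {n : ℕ} (i : Fin n) : Fhat n where
  carrier := {atomPoint i}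
  lower' := by
    rintro w v (h | rfl) hw
    · rw [Set.mem_singleton_iff.1 hw] at h
      simp [atomPoint] at h
    · exact hw

/-- `H` is setwise invariant under all automorphisms of the algebra of decreasing sets. -/
def AutInvariant {n : ℕ} (H : HeytingSubalgebra (Fhat n)) : Prop :=
  ∀ φ : HeytingAut (Fhat n), φ '' (H : Set (Fhat n)) = H

end Bellissima

/-!
The three algebras in question are all Heyting algebras of lower sets of the poset `K n`, and their
automorphisms are automorphisms of this poset.

*Dense subalgebras.* A point of `K n` that is not in `Klevel n d` has a point below it that is in
`Klevel n (d + 1)` but not in `Klevel n d`. Hence a lower set that agrees on `Klevel n (d + 1)` with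
a lower set contained in `Klevel n d` is equal to it, and a dense `H` contains every lower set
bounded by a level (`Bellissima.mem_of_dense`), in particular all `Iic w` and `Iio w`. In an algebra
of lower sets that contains these, the completely join-irreducible elements are exactly the `Iic w`
(`completelyJoinIrreducible_iff`), so that an automorphism of the algebra is induced by one of the
poset (`exists_orderIso_of_joinDense`).

*Automorphisms of the poset.* The number of points `w` with `Iio w = Iic u ∪ Iic v` is
`2 ^ |val u ∩ val v|`, or one less if `u` and `v` are comparable. So a poset automorphism preserves
the numbers `|val u ∩ val v|`; it permutes the minimal points with a single variable, and it changes
all valuations by the resulting permutation of the variables (`Bellissima.exists_actsBy`). On the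
other hand, every finitary poset with a decreasing valuation has a bounded morphism to `K n`
(`Bellissima.exists_boundedMorphism`), and the only one from `K n` to itself is the identity
(`Bellissima.eq_id_of_boundedMorphism`). It follows that each permutation of the variables is induced
by exactly one automorphism of `K n`.

*The free algebra.* The map `sem n` is an order embedding (`Bellissima.sem_le_iff`): a non-theorem
fails in a finite filtration of the canonical model of prime ideals, and this finite model has a
bounded morphism to `K n`. The image of `sem n` contains all `Iic w`, which are defined by the de
Jongh formulae (`Bellissima.Iic_eq_inf_himp`). So the automorphisms of the free algebra are
permutations of the generators. A set of free generators has `n` elements, as one sees by counting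
homomorphisms to the two-element algebra, hence is the image of the standard one under an
automorphism. Finally, the completely join-irreducible elements of the free algebra correspond to the
`Iic w`, so `Fkl n` is generated by the `Iic w`; this makes it dense and invariant.
-/

/-! ### Join-dense representations and automorphisms -/

namespace LowerSet

theorem mem_himp_iff {P : Type*} [Preorder P] {a b : LowerSet P} {x : P} :
    x ∈ a ⇨ b ↔ ∀ y ≤ x, y ∈ a → y ∈ b := by
  rw [← LowerSet.Iic_le, le_himp_iff]
  exact ⟨fun h y hy ha => h ⟨hy, ha⟩, fun h y hy => h y hy.1 hy.2⟩

theorem mem_finsetSup_iff {P ι : Type*} [Preorder P] {s : Finset ι} {f : ι → LowerSet P} {x : P} :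
    x ∈ s.sup f ↔ ∃ i ∈ s, x ∈ f i := by
  classical
  induction s using Finset.induction_on with
  | empty => simp
  | insert a s _ ih => simp [ih]

theorem mem_finsetInf_iff {P ι : Type*} [Preorder P] {s : Finset ι} {f : ι → LowerSet P} {x : P} :
    x ∈ s.inf f ↔ ∀ i ∈ s, x ∈ f i := by
  classical
  induction s using Finset.induction_on with
  | empty => simp
  | insert a s _ ih => simp [ih]

end LowerSet

section JoinDense

variable {P H : Type*} [PartialOrder P] [HeytingAlgebra H] (e : H ↪o LowerSet P)

/-- If `H` is an algebra of lower sets that contains every `Iic w` and every `Iio w`, then its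
completely join-irreducible elements are exactly the `Iic w`: each element is the union of the
`Iic w` it contains, and everything strictly below `Iic w` lies below `Iio w`. -/
theorem completelyJoinIrreducible_iff (hIic : ∀ w, ∃ h, e h = LowerSet.Iic w)
    (hIio : ∀ w, ∃ h, e h = LowerSet.Iio w) {a : H} :
    CompletelyJoinIrreducible a ↔ ∃ w, e a = LowerSet.Iic w := by
  constructor
  · intro ha
    obtain ⟨w, -, hw⟩ := ha {h | ∃ w ∈ e a, e h = LowerSet.Iic w} <| by
      constructor
      · rintro h ⟨w, hw, hh⟩
        rw [← e.le_iff_le, hh]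
        exact LowerSet.Iic_le.2 hw
      · intro b hb
        rw [← e.le_iff_le]
        intro w hw
        obtain ⟨h, hh⟩ := hIic w
        have : e h ≤ e b := e.le_iff_le.2 (hb ⟨w, hw, hh⟩)
        rw [hh] at this
        exact LowerSet.Iic_le.1 this
    exact ⟨w, hw⟩
  · rintro ⟨w, hw⟩ S hS
    by_contra ha
    obtain ⟨h, hh⟩ := hIio w
    have hub : a ≤ h := hS.2 fun s hs => by
      have hle : e s ≤ e a := e.le_iff_le.2 (hS.1 hs)
      rw [← e.le_iff_le, hh]
      intro x hx
      have hxw : x ≤ w := by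
        have := hle hx
        rwa [hw] at this
      refine lt_of_le_of_ne hxw ?_
      rintro rfl
      refine ha ?_
      have : a ≤ s := by
        rw [← e.le_iff_le, hw]
        exact LowerSet.Iic_le.2 hx
      rwa [le_antisymm this (hS.1 hs)]
    rw [← e.le_iff_le, hh, hw] at hub
    exact lt_irrefl w (LowerSet.Iic_le.1 hub)

theorem CompletelyJoinIrreducible.map_orderIso {A B : Type*} [HeytingAlgebra A] [HeytingAlgebra B]
    (α : A ≃o B) {a : A} (ha : CompletelyJoinIrreducible a) : CompletelyJoinIrreducible (α a) := by
  intro S hS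
  have := ha (α ⁻¹' S) (by simpa using (α.isLUB_preimage' (s := S) (x := α a)).2 hS)
  exact this

/-- An automorphism of such an algebra permutes the `Iic w`, hence is induced by an automorphism
of the underlying poset. -/
theorem exists_orderIso_of_joinDense (hIic : ∀ w, ∃ h, e h = LowerSet.Iic w)
    (hIio : ∀ w, ∃ h, e h = LowerSet.Iio w) (α : HeytingAut H) :
    ∃ φ : P ≃o P, ∀ h, e (α h) = LowerSet.map φ (e h) := by
  have key : ∀ (α : HeytingAut H) (w : P), ∃ w', ∀ h, e h = LowerSet.Iic w →
      e (α h) = LowerSet.Iic w' := fun α w => by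
    obtain ⟨h, hh⟩ := hIic w
    obtain ⟨w', hw'⟩ := (completelyJoinIrreducible_iff e hIic hIio).1
      (((completelyJoinIrreducible_iff e hIic hIio).2 ⟨w, hh⟩).map_orderIso α)
    refine ⟨w', fun k hk => ?_⟩
    rwa [e.injective (hk.trans hh.symm)]
  choose f hf using key α
  choose g hg using key α.symm
  have hgf : ∀ w, g (f w) = w := fun w => by
    obtain ⟨h, hh⟩ := hIic w
    have := hg (f w) (α h) (hf w h hh)
    rw [OrderIso.symm_apply_apply, hh] at this
    exact (LowerSet.Iic_injective this).symm
  have hfg : ∀ w, f (g w) = w := fun w => by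
    obtain ⟨h, hh⟩ := hIic w
    have := hf (g w) (α.symm h) (hg w h hh)
    rw [OrderIso.apply_symm_apply, hh] at this
    exact (LowerSet.Iic_injective this).symm
  have hmem : ∀ w h, f w ∈ e (α h) ↔ w ∈ e h := fun w h => by
    obtain ⟨k, hk⟩ := hIic w
    rw [← LowerSet.Iic_le, ← hf w k hk, e.le_iff_le, α.le_iff_le, ← e.le_iff_le, hk,
      LowerSet.Iic_le]
  refine ⟨⟨⟨f, g, hgf, hfg⟩, fun {v w} => ?_⟩, fun h => ?_⟩
  · obtain ⟨k, hk⟩ := hIic w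
    have := hmem v k
    rwa [hf w k hk, hk, LowerSet.mem_Iic_iff, LowerSet.mem_Iic_iff] at this
  · ext w
    change w ∈ e (α h) ↔ w ∈ LowerSet.map _ (e h)
    rw [LowerSet.mem_map]
    change _ ↔ g w ∈ e h
    rw [← hmem (g w) h, hfg]

end JoinDense

/-! ### Heyting subalgebras -/

namespace HeytingSubalgebra

variable {A B : Type*} [HeytingAlgebra A] [HeytingAlgebra B]

theorem subset_closure (S : Set A) : S ⊆ (closure S : Set A) := fun _ hx _ hL => hL hx

theorem closure_le {S : Set A} {L : HeytingSubalgebra A} (h : S ⊆ (L : Set A)) :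
    (closure S : Set A) ⊆ (L : Set A) := fun _ hx => hx L h

/-- The preimage of a Heyting subalgebra under a homomorphism. -/
def comap (f : HeytingHom A B) (L : HeytingSubalgebra B) : HeytingSubalgebra A where
  carrier := f ⁻¹' (L : Set B)
  bot_mem' := by
    rw [Set.mem_preimage, map_bot]
    exact L.bot_mem'
  top_mem' := by
    rw [Set.mem_preimage, map_top]
    exact L.top_mem'
  inf_mem' ha hb := by
    rw [Set.mem_preimage, map_inf]
    exact L.inf_mem' ha hb
  sup_mem' ha hb := by
    rw [Set.mem_preimage, map_sup]
    exact L.sup_mem' ha hb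
  himp_mem' ha hb := by
    rw [Set.mem_preimage, map_himp]
    exact L.himp_mem' ha hb

theorem coe_map_closure (f : HeytingHom A B) (S : Set A) :
    ((closure S).map f : Set B) = closure (f '' S) := by
  apply Set.Subset.antisymm
  · rintro _ ⟨a, ha, rfl⟩
    exact closure_le (L := comap f (closure (f '' S)))
      (fun s hs => subset_closure _ (Set.mem_image_of_mem f hs)) ha
  · exact closure_le (Set.image_mono (subset_closure S))

/-- The inclusion of a Heyting subalgebra. -/
def orderEmbedding (L : HeytingSubalgebra A) : L ↪o A :=
  ⟨⟨Subtype.val, Subtype.val_injective⟩, Iff.rfl⟩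

theorem finsetSup_mem (L : HeytingSubalgebra A) {ι : Type*} {s : Finset ι} {f : ι → A}
    (h : ∀ i ∈ s, f i ∈ L) : s.sup f ∈ L :=
  Finset.sup_induction L.bot_mem' (fun _ ha _ hb => L.sup_mem' ha hb) h

theorem finsetInf_mem (L : HeytingSubalgebra A) {ι : Type*} {s : Finset ι} {f : ι → A}
    (h : ∀ i ∈ s, f i ∈ L) : s.inf f ∈ L :=
  Finset.inf_induction L.top_mem' (fun _ ha _ hb => L.inf_mem' ha hb) h

end HeytingSubalgebra

/-! ### The points of the generic Kripke model -/

namespace Bellissima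

variable {n : ℕ}

theorem level_mono (n : ℕ) : Monotone (level n) := monotone_nat_of_le_succ (level_mono_succ n)

theorem code_eta : ∀ {d w : ℕ}, w ∈ level n d → code (codeVal n w) (codeBelow n w) = w
  | 1, w, ⟨β, h⟩ => by simp [h]
  | d + 2, w, h => by
    rcases h with h | ⟨β, Y, rfl, -⟩
    · exact code_eta h
    · simp

theorem codeVal_ne : ∀ {d w : ℕ}, w ∈ level n d → ∀ v ∈ codeBelow n w,
    codeBelow n w = insert v (codeBelow n v) → codeVal n w ≠ codeVal n v
  | 1, w, ⟨β, h⟩ => by simp [h]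
  | d + 2, w, h => by
    rcases h with h | ⟨β, Y, rfl, -, -, -, -, h⟩
    · exact codeVal_ne h
    · simpa using h

theorem level_finite (n : ℕ) : ∀ d, (level n d).Finite
  | 0 => Set.finite_empty
  | 1 => (Set.finite_range fun β : Finset (Fin n) => code β ∅).subset <| by
    rintro w ⟨β, rfl⟩
    exact ⟨β, rfl⟩
  | d + 2 => by
    refine (level_finite n (d + 1)).union ?_
    refine (Set.Finite.image2 (fun (β : Finset (Fin n)) Y => code β Y) Set.finite_univ
      ((level_finite n (d + 1)).finite_subsets.preimage
        (Finset.coe_injective.injOn))).subset ?_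
    rintro w ⟨β, Y, rfl, hY, -⟩
    exact ⟨β, trivial, Y, hY, rfl⟩

theorem lt_iff {v w : K n} : v < w ↔ v.1 ∈ codeBelow n w.1 := by
  rw [lt_iff_le_and_ne]
  constructor
  · rintro ⟨h | h, h'⟩
    · exact h
    · exact absurd h h'
  · refine fun h => ⟨Or.inl h, ?_⟩
    rintro rfl
    obtain ⟨d, hd⟩ := v.2
    exact not_mem_codeBelow hd h

theorem exists_eq_of_mem_level {d u : ℕ} (hu : u ∈ level n d) : ∃ v : K n, v.1 = u :=
  ⟨⟨u, d, hu⟩, rfl⟩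

theorem exists_lt_of_mem_codeBelow {w : K n} {u : ℕ} (hu : u ∈ codeBelow n w.1) :
    ∃ v < w, v.1 = u := by
  obtain ⟨d, h⟩ := w.2
  obtain ⟨v, rfl⟩ := exists_eq_of_mem_level ((level_spec (level_mono_succ n d h)).1 hu)
  exact ⟨v, lt_iff.2 hu, rfl⟩

theorem val_antitone : Antitone (K.val : K n → Finset (Fin n)) := by
  rintro v w (h | rfl)
  · exact (spec w).2 _ h
  · exact le_rfl

instance : WellFoundedLT (K n) :=
  StrictMono.wellFoundedLT (f := fun w : K n => codeBelow n w.1) fun v w h => by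
    rw [lt_iff] at h
    refine (Finset.ssubset_iff_of_subset ((spec w).1 _ h)).2 ⟨_, h, ?_⟩
    obtain ⟨d, hd⟩ := v.2
    exact not_mem_codeBelow hd

theorem finite_Iio (w : K n) : (Set.Iio w).Finite := by
  refine ((codeBelow n w.1).finite_toSet.preimage Subtype.val_injective.injOn).subset ?_
  exact fun v hv => lt_iff.1 hv

theorem finite_Iic (w : K n) : (Set.Iic w).Finite := by
  rw [← Set.Iio_insert]
  exact (finite_Iio w).insert w

/-- A point is determined by its valuation and the points strictly below it. -/
theorem ext_of_Iio {v w : K n} (hval : v.val = w.val) (h : Set.Iio v = Set.Iio w) : v = w := by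
  have hb : codeBelow n v.1 = codeBelow n w.1 := by
    ext u
    constructor
    · intro hu
      obtain ⟨x, hx, rfl⟩ := exists_lt_of_mem_codeBelow hu
      exact lt_iff.1 (h.subset (Set.mem_Iio.2 hx))
    · intro hu
      obtain ⟨x, hx, rfl⟩ := exists_lt_of_mem_codeBelow hu
      exact lt_iff.1 (h.superset (Set.mem_Iio.2 hx))
  obtain ⟨d, hd⟩ := v.2
  obtain ⟨d', hd'⟩ := w.2
  apply Subtype.ext
  rw [← code_eta hd, ← code_eta hd', hb]
  exact congrArg (code · _) hval

theorem val_ne_of_Iio_eq_Iic {v w : K n} (h : Set.Iio w = Set.Iic v) : w.val ≠ v.val := by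
  have hvw : v < w := h.superset Set.self_mem_Iic
  obtain ⟨d, hd⟩ := w.2
  refine codeVal_ne hd v.1 (lt_iff.1 hvw) ?_
  ext u
  rw [Finset.mem_insert]
  constructor
  · intro hu
    obtain ⟨x, hx, rfl⟩ := exists_lt_of_mem_codeBelow hu
    rcases h.subset (Set.mem_Iio.2 hx) with h | rfl
    · exact Or.inr h
    · exact Or.inl rfl
  · rintro (rfl | hu)
    · exact lt_iff.1 hvw
    · exact (spec w).1 _ (lt_iff.1 hvw) hu

theorem exists_Iio_eq {Y : Set (K n)} (hfin : Y.Finite) (hlow : IsLowerSet Y)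
    {β : Finset (Fin n)} (hβ : ∀ v ∈ Y, β ⊆ v.val) (hne : ∀ v, Y = Set.Iic v → β ≠ v.val) :
    ∃ w : K n, w.val = β ∧ Set.Iio w = Y := by
  obtain ⟨Y', hY'⟩ : ∃ Y' : Finset ℕ, (Y' : Set ℕ) = Subtype.val '' Y :=
    ⟨(hfin.image _).toFinset, Set.Finite.coe_toFinset _⟩
  have hmem : ∀ v : K n, v.1 ∈ Y' ↔ v ∈ Y := fun v => by
    rw [← Finset.mem_coe, hY']
    exact Subtype.val_injective.mem_set_image
  have hpt : ∀ u ∈ Y', ∃ v : K n, v.1 = u ∧ v ∈ Y := fun u hu => by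
    rw [← Finset.mem_coe, hY'] at hu
    obtain ⟨v, hv, rfl⟩ := hu
    exact ⟨v, rfl, hv⟩
  suffices h : ∃ d, code β Y' ∈ level n d by
    obtain ⟨d, hd⟩ := h
    obtain ⟨w, hw⟩ := exists_eq_of_mem_level hd
    refine ⟨w, by simp [K.val, hw], ?_⟩
    ext v
    rw [Set.mem_Iio, lt_iff, hw, codeBelow_code, hmem]
  have hex : ∃ d, (Y' : Set ℕ) ⊆ level n d := by
    have : ∀ s : Finset ℕ, s ⊆ Y' → ∃ d, (s : Set ℕ) ⊆ level n d := fun s => by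
      induction s using Finset.induction_on with
      | empty => exact fun _ => ⟨0, by simp⟩
      | insert a s _ ih =>
        intro hs
        obtain ⟨d, hd⟩ := ih ((Finset.subset_insert a s).trans hs)
        obtain ⟨v, rfl, -⟩ := hpt a (hs (Finset.mem_insert_self a s))
        obtain ⟨d', hd'⟩ := v.2
        refine ⟨max d d', ?_⟩
        rw [Finset.coe_insert]
        exact Set.insert_subset (level_mono n (le_max_right _ _) hd')
          (hd.trans (level_mono n (le_max_left _ _)))
    exact this Y' subset_rfl
  -- the point appears directly after the first level that contains `Y`
  classical
  rcases hd : Nat.find hex with _ | d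
  · have h := Nat.find_spec hex
    rw [hd] at h
    have hempty : Y' = ∅ := Finset.coe_eq_empty.1 (Set.subset_empty_iff.1 h)
    exact ⟨1, β, by rw [hempty]⟩
  · refine ⟨d + 2, Or.inr ⟨β, Y', rfl, hd ▸ Nat.find_spec hex, ?_, ?_, ?_, ?_⟩⟩
    · intro v hv u hu
      obtain ⟨v, rfl, hvY⟩ := hpt v hv
      obtain ⟨x, hx, rfl⟩ := exists_lt_of_mem_codeBelow hu
      exact (hmem x).2 (hlow hx.le hvY)
    · exact Nat.find_min hex (by omega)
    · intro v hv
      obtain ⟨v, rfl, hvY⟩ := hpt v hv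
      exact hβ v hvY
    · intro v hv hY
      obtain ⟨v, rfl, hvY⟩ := hpt v hv
      refine hne v ?_
      ext u
      rw [← hmem, hY, Finset.mem_insert, ← lt_iff, Set.mem_Iic, le_iff_eq_or_lt]
      exact or_congr_left ⟨fun h => Subtype.ext h, congrArg Subtype.val⟩

/-- Over a finite lower set `Y` and under any admissible valuation `β`, there is a point whose
down-set is `Y` together with the point itself. It is a new point above `Y`, unless `Y` is the
down-set of a point of valuation `β`, which then serves. -/
theorem exists_Iic_eq_insert {Y : Set (K n)} (hfin : Y.Finite) (hlow : IsLowerSet Y)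
    {β : Finset (Fin n)} (hβ : ∀ v ∈ Y, β ⊆ v.val) :
    ∃ w : K n, w.val = β ∧ Set.Iic w = insert w Y := by
  by_cases h : ∃ v, Y = Set.Iic v ∧ β = v.val
  · obtain ⟨v, hv, rfl⟩ := h
    exact ⟨v, rfl, by simp [hv]⟩
  · push Not at h
    obtain ⟨w, hw, hY⟩ := exists_Iio_eq hfin hlow hβ h
    exact ⟨w, hw, by rw [← hY, Set.Iio_insert]⟩

theorem val_atomPoint (i : Fin n) : (atomPoint i).val = {i} := by simp [K.val, atomPoint]

theorem Iio_atomPoint (i : Fin n) : Set.Iio (atomPoint i) = ∅ := by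
  ext v
  rw [Set.mem_Iio, lt_iff, atomPoint, codeBelow_code]
  simp

theorem preGen_eq_Iic (i : Fin n) : preGen i = LowerSet.Iic (atomPoint i) := by
  apply SetLike.coe_injective
  rw [LowerSet.coe_Iic, ← Set.Iio_insert, Iio_atomPoint, insert_empty_eq]
  rfl

theorem atomPoint_injective : Function.Injective (atomPoint : Fin n → K n) := fun i j h => by
  have := val_atomPoint i
  rw [h, val_atomPoint] at this
  exact (Finset.singleton_injective this).symm

theorem preGen_injective : Function.Injective (preGen : Fin n → Fhat n) := fun i j h => by
  rw [preGen_eq_Iic, preGen_eq_Iic] at h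
  exact atomPoint_injective (LowerSet.Iic_injective h)

theorem mem_P {i : Fin n} {w : K n} : w ∈ P i ↔ i ∈ w.val := Iff.rfl

/-! ### Levels and density -/

theorem Klevel_finite (d : ℕ) : (Klevel n d).Finite :=
  (level_finite n (d + 1)).preimage Subtype.val_injective.injOn

theorem Klevel_mono : Monotone (Klevel n) := fun _ _ h _ hw =>
  level_mono n (Nat.succ_le_succ h) hw

theorem exists_mem_Klevel (w : K n) : ∃ d, w ∈ Klevel n d := by
  obtain ⟨d, hd⟩ := w.2
  exact ⟨d, level_mono_succ n d hd⟩

theorem isLowerSet_Klevel (d : ℕ) : IsLowerSet (Klevel n d) := by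
  rintro w v (h | rfl) hw
  · exact level_mono_succ n d ((level_spec hw).1 h)
  · exact hw

/-- Above level `d` one cannot skip level `d + 1`. -/
theorem exists_le_mem_Klevel_succ {d e : ℕ} : ∀ {w : K n}, w.1 ∈ level n e → w ∉ Klevel n d →
    ∃ u ≤ w, u ∈ Klevel n (d + 1) ∧ u ∉ Klevel n d := by
  induction e using Nat.strong_induction_on with
  | _ e ih =>
    intro w hw hd
    rcases e with _ | _ | k
    · exact absurd hw (Set.notMem_empty _)
    · exact absurd (level_mono n (Nat.le_add_left 1 d) hw) hd
    · rcases id hw with hw | ⟨β, Y, hc, hY, -, hk, -⟩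
      · exact ih (k + 1) (by omega) hw hd
      · rcases Nat.lt_or_ge d k with hdk | hdk
        · obtain ⟨v, hv, hvk⟩ := Set.not_subset.1 hk
          obtain ⟨v, rfl⟩ := exists_eq_of_mem_level (hY hv)
          have hlt : v < w := by
            rw [lt_iff, hc, codeBelow_code]
            exact hv
          obtain ⟨u, hu, h⟩ := ih (k + 1) (by omega) (hY hv)
            fun h => hvk (level_mono n (by omega) h)
          exact ⟨u, hu.trans hlt.le, h⟩
        · exact ⟨w, le_rfl, level_mono n (by omega : k + 2 ≤ d + 2) hw, hd⟩

/-- Density means approximating every lower set on every level. -/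
theorem dense_iff_forall_inter {s : Set (Fhat n)} :
    Dense s ↔ ∀ (a : Fhat n) (d : ℕ), ∃ h ∈ s,
      (h : Set (K n)) ∩ Klevel n d = (a : Set (K n)) ∩ Klevel n d := by
  classical
  rw [Metric.dense_iff]
  have hdist : ∀ a b : Fhat n, dist a b = FhatDist a b := fun _ _ => rfl
  constructor
  · intro H a d
    obtain ⟨h, hh, hs⟩ := H a ((2 : ℝ)⁻¹ ^ d) (by positivity)
    refine ⟨h, hs, ?_⟩
    by_contra hne
    have hex : ∃ i, (h : Set (K n)) ∩ Klevel n i ≠ (a : Set (K n)) ∩ Klevel n i := ⟨d, hne⟩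
    rw [Metric.mem_ball, hdist, FhatDist, dif_pos hex] at hh
    exact absurd hh (not_lt.2 (pow_le_pow_of_le_one (by norm_num) (by norm_num)
      (Nat.find_min' hex hne)))
  · intro H a r hr
    obtain ⟨d, hd⟩ := exists_pow_lt_of_lt_one hr (by norm_num : (2 : ℝ)⁻¹ < 1)
    obtain ⟨h, hs, hh⟩ := H a d
    refine ⟨h, ?_, hs⟩
    rw [Metric.mem_ball, hdist, FhatDist]
    split_ifs with hex
    · refine lt_of_le_of_lt (pow_le_pow_of_le_one (by norm_num) (by norm_num) ?_) hd
      by_contra! hlt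
      refine Nat.find_spec hex ?_
      have := congrArg (· ∩ Klevel n (Nat.find hex)) hh
      simpa only [Set.inter_assoc,
        Set.inter_eq_right.2 (Klevel_mono (n := n) hlt.le)] using this
    · exact hr

/-- A dense set contains every lower set `a` bounded by a level: an element that agrees with `a`
on one level more has no points there, and so has none further up. -/
theorem mem_of_dense {s : Set (Fhat n)} (hs : Dense s) {a : Fhat n} {d : ℕ}
    (ha : (a : Set (K n)) ⊆ Klevel n d) : a ∈ s := by
  obtain ⟨h, hmem, hh⟩ := dense_iff_forall_inter.1 hs a (d + 1)
  have hd : (h : Set (K n)) ⊆ Klevel n d := fun w hw => by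
    by_contra hwd
    obtain ⟨e, he⟩ := w.2
    obtain ⟨u, huw, hu, hud⟩ := exists_le_mem_Klevel_succ he hwd
    exact hud (ha (hh.subset ⟨h.lower huw hw, hu⟩).1)
  rw [Set.inter_eq_left.2 (hd.trans (Klevel_mono d.le_succ)),
    Set.inter_eq_left.2 (ha.trans (Klevel_mono d.le_succ))] at hh
  rwa [← SetLike.coe_injective hh]

theorem Iic_mem_of_dense {s : Set (Fhat n)} (hs : Dense s) (w : K n) : LowerSet.Iic w ∈ s := by
  obtain ⟨d, hd⟩ := exists_mem_Klevel w
  exact mem_of_dense hs (d := d) fun v hv => isLowerSet_Klevel d hv hd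

theorem Iio_mem_of_dense {s : Set (Fhat n)} (hs : Dense s) (w : K n) : LowerSet.Iio w ∈ s := by
  obtain ⟨d, hd⟩ := exists_mem_Klevel w
  exact mem_of_dense hs (d := d) fun v hv => isLowerSet_Klevel d (le_of_lt hv) hd

theorem finite_mem_of_Iic_mem {L : HeytingSubalgebra (Fhat n)} (hL : ∀ w, LowerSet.Iic w ∈ L)
    {a : Fhat n} (ha : (a : Set (K n)).Finite) : a ∈ L := by
  have : a = ha.toFinset.sup LowerSet.Iic := by
    apply SetLike.ext
    intro w
    simp only [LowerSet.mem_finsetSup_iff, Set.Finite.mem_toFinset, SetLike.mem_coe,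
      LowerSet.mem_Iic_iff]
    exact ⟨fun hw => ⟨w, hw, le_rfl⟩, fun ⟨v, hv, hwv⟩ => a.lower hwv hv⟩
  rw [this]
  exact L.finsetSup_mem fun w _ => hL w

theorem dense_of_Iic_mem {L : HeytingSubalgebra (Fhat n)} (hL : ∀ w, LowerSet.Iic w ∈ L) :
    Dense (L : Set (Fhat n)) := by
  rw [dense_iff_forall_inter]
  intro a d
  refine ⟨⟨(a : Set (K n)) ∩ Klevel n d, a.lower.inter (isLowerSet_Klevel d)⟩,
    finite_mem_of_Iic_mem hL ((Klevel_finite d).subset Set.inter_subset_right), ?_⟩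
  exact Set.inter_eq_left.2 Set.inter_subset_right

end Bellissima

/-! ### Bounded morphisms into the generic Kripke model -/

namespace Bellissima

variable {n : ℕ}

/-- Every finitary poset `M` with a decreasing valuation `β` has a valuation-preserving bounded
morphism to the generic Kripke model, built by recursion along the order. -/
theorem exists_boundedMorphism {M : Type*} [PartialOrder M] [WellFoundedLT M]
    (hfin : ∀ m : M, (Set.Iio m).Finite) {β : M → Finset (Fin n)} (hβ : Antitone β) :
    ∃ f : M → K n, (∀ m, (f m).val = β m) ∧ ∀ m, f '' Set.Iic m = Set.Iic (f m) := by
  have : Nonempty (K n) := (exists_Iic_eq_insert (n := n) Set.finite_empty isLowerSet_empty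
    (β := ∅) (by simp)).nonempty
  -- the points that may serve as the value at `m`, when `Y` is the set generated by earlier values
  let Q (m : M) (Y : Set (K n)) (w : K n) : Prop := w.val = β m ∧ Set.Iic w = insert w Y
  let f : M → K n := WellFoundedLT.fix fun m g =>
    Classical.epsilon (Q m (⋃ y : Set.Iio m, Set.Iic (g y.1 y.2)))
  have hf : ∀ m, f m = Classical.epsilon (Q m (⋃ y : Set.Iio m, Set.Iic (f y))) := fun m =>
    WellFoundedLT.fix_eq _ m
  have hQ : ∀ m, Q m (⋃ y : Set.Iio m, Set.Iic (f y)) (f m) := fun m => by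
    induction m using WellFoundedLT.induction with
    | _ m ih =>
      rw [hf m]
      apply Classical.epsilon_spec (p := Q m (⋃ y : Set.Iio m, Set.Iic (f y)))
      have := (hfin m).to_subtype
      refine exists_Iic_eq_insert (Set.finite_iUnion fun y => finite_Iic _)
        (isLowerSet_iUnion fun y => isLowerSet_Iic _) fun v hv => ?_
      obtain ⟨y, hy⟩ := Set.mem_iUnion.1 hv
      calc β m ⊆ β y := hβ y.2.le
        _ = (f y).val := (ih y y.2).1.symm
        _ ⊆ v.val := val_antitone hy
  refine ⟨f, fun m => (hQ m).1, fun m => ?_⟩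
  induction m using WellFoundedLT.induction with
  | _ m ih =>
    have hU : Set.Iio m = ⋃ y : Set.Iio m, Set.Iic (y : M) := by
      ext x
      simp only [Set.mem_iUnion, Set.mem_Iic, Set.mem_Iio, Subtype.exists, exists_prop]
      exact ⟨fun h => ⟨x, h, le_rfl⟩, fun ⟨y, hy, hxy⟩ => hxy.trans_lt hy⟩
    rw [(hQ m).2, ← Set.Iio_insert, Set.image_insert_eq]
    congr 1
    conv_lhs => rw [hU]
    rw [Set.image_iUnion]
    exact Set.iUnion_congr fun y => ih y y.2

/-- The identity is the only valuation-preserving bounded morphism of the generic Kripke model to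
itself. -/
theorem eq_id_of_boundedMorphism {f : K n → K n} (hval : ∀ w, (f w).val = w.val)
    (hf : ∀ w, f '' Set.Iic w = Set.Iic (f w)) (w : K n) : f w = w := by
  induction w using WellFoundedLT.induction with
  | _ w ih =>
    have hI : Set.Iic (f w) = insert (f w) (Set.Iio w) := by
      rw [← hf w, ← Set.Iio_insert, Set.image_insert_eq]
      exact congrArg _ ((Set.image_congr (g := id) fun y hy => ih y hy).trans (Set.image_id _))
    by_cases hw : f w < w
    · -- then `w` lies directly over `f w` with the same valuation, which does not happen
      rw [Set.insert_eq_of_mem (show f w ∈ Set.Iio w from hw)] at hI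
      exact absurd (hval w).symm (val_ne_of_Iio_eq_Iic hI.symm)
    · refine ext_of_Iio (hval w) ?_
      rw [← Set.Iic_sdiff_right, hI]
      exact Set.insert_sdiff_self_of_notMem hw

/-! ### Automorphisms of the generic Kripke model -/

/-- The automorphism `φ` of the generic Kripke model moves valuations by the permutation `σ` of the
variables: `val (φ w) = σ (val w)` for all points `w`. -/
def ActsBy (φ : K n ≃o K n) (σ : Equiv.Perm (Fin n)) : Prop :=
  ∀ w i, σ i ∈ (φ w).val ↔ i ∈ w.val

theorem ActsBy.unique {φ ψ : K n ≃o K n} {σ : Equiv.Perm (Fin n)} (hφ : ActsBy φ σ)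
    (hψ : ActsBy ψ σ) : φ = ψ := by
  ext w
  refine (ψ.symm_apply_eq).1 (eq_id_of_boundedMorphism (f := φ.trans ψ.symm) (fun w => ?_)
    (fun w => (φ.trans ψ.symm).image_Iic w) w)
  ext i
  rw [← hψ, OrderIso.trans_apply, OrderIso.apply_symm_apply, hφ]

theorem ActsBy.map_P {φ : K n ≃o K n} {σ : Equiv.Perm (Fin n)} (hφ : ActsBy φ σ) (i : Fin n) :
    LowerSet.map φ (P i) = P (σ i) := by
  apply SetLike.ext
  intro w
  rw [LowerSet.mem_map, mem_P, mem_P, ← hφ, OrderIso.apply_symm_apply]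

theorem ActsBy.map_preGen {φ : K n ≃o K n} {σ : Equiv.Perm (Fin n)} (hφ : ActsBy φ σ)
    (i : Fin n) : LowerSet.map φ (preGen i) = preGen (σ i) := by
  have h : φ (atomPoint i) = atomPoint (σ i) := by
    refine ext_of_Iio ?_ ?_
    · ext j
      obtain ⟨j, rfl⟩ := σ.surjective j
      rw [hφ, val_atomPoint, val_atomPoint, Finset.mem_singleton, Finset.mem_singleton,
        σ.injective.eq_iff]
    · rw [← OrderIso.image_Iio, Iio_atomPoint, Iio_atomPoint, Set.image_empty]
  rw [preGen_eq_Iic, preGen_eq_Iic, LowerSet.map_Iic, h]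

/-- Permuting the variables gives another decreasing valuation on `K n`; the bounded morphism for it
is invertible, its inverse being the one for the inverse permutation. -/
theorem exists_orderIso_actsBy (σ : Equiv.Perm (Fin n)) : ∃ φ : K n ≃o K n, ActsBy φ σ := by
  have key : ∀ σ : Equiv.Perm (Fin n), ∃ f : K n → K n, Monotone f ∧
      (∀ w i, σ i ∈ (f w).val ↔ i ∈ w.val) ∧ ∀ w, f '' Set.Iic w = Set.Iic (f w) := fun σ => by
    obtain ⟨f, hval, hf⟩ := exists_boundedMorphism (n := n) (finite_Iio (n := n))
      (β := fun w => w.val.map σ.toEmbedding) fun v w h => Finset.map_subset_map.2 (val_antitone h)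
    refine ⟨f, fun v w h => (hf w).subset (Set.mem_image_of_mem f h), fun w i => ?_, hf⟩
    rw [hval]
    exact Finset.mem_map' σ.toEmbedding
  obtain ⟨f, hfm, hfval, hf⟩ := key σ
  obtain ⟨g, hgm, hgval, hg⟩ := key σ.symm
  have hgf : ∀ w, g (f w) = w := eq_id_of_boundedMorphism (f := g ∘ f)
    (fun w => by
      ext i
      have := hgval (f w) (σ i)
      rw [σ.symm_apply_apply, hfval] at this
      exact this)
    fun w => by rw [Set.image_comp, hf, hg]; rfl
  have hfg : ∀ w, f (g w) = w := eq_id_of_boundedMorphism (f := f ∘ g)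
    (fun w => by
      ext i
      have := hfval (g w) (σ.symm i)
      rw [hgval, σ.apply_symm_apply] at this
      exact this)
    fun w => by rw [Set.image_comp, hg, hf]; rfl
  exact ⟨⟨⟨f, g, hgf, hfg⟩, fun {v w} => ⟨fun h => by simpa [hgf] using hgm h, fun h => hfm h⟩⟩,
    hfval⟩

theorem injOn_val_of_Iio_eq (Y : Set (K n)) : Set.InjOn K.val {w : K n | Set.Iio w = Y} :=
  fun _ hv _ hw h => ext_of_Iio h (Eq.trans hv (Eq.symm hw))

/-- The points directly above a single point `v` correspond to the proper subsets of `val v`. -/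
theorem ncard_Iio_eq_Iic (v : K n) :
    {w : K n | Set.Iio w = Set.Iic v}.ncard = 2 ^ v.val.card - 1 := by
  have himg : K.val '' {w : K n | Set.Iio w = Set.Iic v} = (v.val.powerset.erase v.val :) := by
    ext β
    rw [Finset.mem_coe, Finset.mem_erase, Finset.mem_powerset]
    constructor
    · rintro ⟨w, hw, rfl⟩
      exact ⟨val_ne_of_Iio_eq_Iic hw, val_antitone (le_of_lt (hw.superset Set.self_mem_Iic))⟩
    · rintro ⟨hne, hβ⟩
      obtain ⟨w, hw, hI⟩ := exists_Iio_eq (finite_Iic v) (isLowerSet_Iic v) (β := β)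
        (fun u hu => hβ.trans (val_antitone hu)) fun u hu => by rwa [← Set.Iic_injective hu]
      exact ⟨w, hI, hw⟩
  rw [← (injOn_val_of_Iio_eq _).ncard_image, himg, Set.ncard_coe_finset,
    Finset.card_erase_of_mem (Finset.mem_powerset_self _), Finset.card_powerset]

/-- The points directly above two incomparable points `u`, `v` correspond to the subsets of
`val u ∩ val v`; the union of the two down-sets is not principal, so that none is excluded. -/
theorem ncard_Iio_eq_union {u v : K n} (huv : ¬ u ≤ v) (hvu : ¬ v ≤ u) :
    {w : K n | Set.Iio w = Set.Iic u ∪ Set.Iic v}.ncard = 2 ^ (u.val ∩ v.val).card := by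
  have himg : K.val '' {w : K n | Set.Iio w = Set.Iic u ∪ Set.Iic v} =
      ((u.val ∩ v.val).powerset :) := by
    ext β
    rw [Finset.mem_coe, Finset.mem_powerset]
    constructor
    · rintro ⟨w, hw, rfl⟩
      exact Finset.subset_inter
        (val_antitone (le_of_lt (hw.superset (Or.inl Set.self_mem_Iic))))
        (val_antitone (le_of_lt (hw.superset (Or.inr Set.self_mem_Iic))))
    · intro hβ
      obtain ⟨hβu, hβv⟩ := Finset.subset_inter_iff.1 hβ
      obtain ⟨w, hw, hI⟩ := exists_Iio_eq ((finite_Iic u).union (finite_Iic v))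
        ((isLowerSet_Iic u).union (isLowerSet_Iic v)) (β := β)
        (fun x hx => hx.elim (fun h => hβu.trans (val_antitone h))
          fun h => hβv.trans (val_antitone h))
        fun x hx => by
          have hu : u ≤ x := hx.subset (Or.inl Set.self_mem_Iic)
          have hv : v ≤ x := hx.subset (Or.inr Set.self_mem_Iic)
          rcases hx.superset Set.self_mem_Iic with h | h
          · exact absurd (hv.trans h) hvu
          · exact absurd (hu.trans h) huv
      exact ⟨w, hI, hw⟩
  rw [← (injOn_val_of_Iio_eq _).ncard_image, himg, Set.ncard_coe_finset, Finset.card_powerset]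

theorem ncard_Iio_eq_image (φ : K n ≃o K n) (Y : Set (K n)) :
    {w : K n | Set.Iio w = φ '' Y}.ncard = {w : K n | Set.Iio w = Y}.ncard := by
  rw [← Set.ncard_image_of_injective {w : K n | Set.Iio w = Y} φ.injective]
  congr 1
  ext w
  obtain ⟨w, rfl⟩ := φ.surjective w
  rw [φ.injective.mem_set_image, Set.mem_ofPred_eq, Set.mem_ofPred_eq, ← OrderIso.image_Iio,
    φ.injective.image_injective.eq_iff]

theorem card_val_orderIso (φ : K n ≃o K n) (v : K n) : (φ v).val.card = v.val.card := by
  have h := ncard_Iio_eq_image φ (Set.Iic v)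
  rw [φ.image_Iic, ncard_Iio_eq_Iic, ncard_Iio_eq_Iic] at h
  have h₁ := Nat.one_le_two_pow (n := (φ v).val.card)
  have h₂ := Nat.one_le_two_pow (n := v.val.card)
  exact Nat.pow_right_injective le_rfl (show 2 ^ _ = 2 ^ _ by omega)

/-- The order of the generic Kripke model alone knows how many variables hold at two given points:
it is read off from the number of points that lie directly above the two down-sets. -/
theorem card_val_inter_orderIso (φ : K n ≃o K n) (u v : K n) :
    ((φ u).val ∩ (φ v).val).card = (u.val ∩ v.val).card := by
  by_cases huv : u ≤ v
  · rw [Finset.inter_eq_right.2 (val_antitone huv),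
      Finset.inter_eq_right.2 (val_antitone (φ.monotone huv)), card_val_orderIso]
  by_cases hvu : v ≤ u
  · rw [Finset.inter_eq_left.2 (val_antitone hvu),
      Finset.inter_eq_left.2 (val_antitone (φ.monotone hvu)), card_val_orderIso]
  have h := ncard_Iio_eq_image φ (Set.Iic u ∪ Set.Iic v)
  rw [Set.image_union, φ.image_Iic, φ.image_Iic, ncard_Iio_eq_union huv hvu,
    ncard_Iio_eq_union (by rwa [φ.le_iff_le]) (by rwa [φ.le_iff_le])] at h
  exact Nat.pow_right_injective le_rfl h

/-- Every automorphism of the poset permutes the points `atomPoint i`, and whether `P_i` holds at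
`w` is told by the number of common variables of `w` and `atomPoint i`. -/
theorem exists_actsBy (φ : K n ≃o K n) : ∃ σ, ActsBy φ σ := by
  have hatom : ∀ i, ∃ j, φ (atomPoint i) = atomPoint j := fun i => by
    have hc := card_val_orderIso φ (atomPoint i)
    rw [val_atomPoint, Finset.card_singleton, Finset.card_eq_one] at hc
    obtain ⟨j, hj⟩ := hc
    refine ⟨j, ext_of_Iio (hj.trans (val_atomPoint j).symm) ?_⟩
    rw [← OrderIso.image_Iio, Iio_atomPoint, Iio_atomPoint, Set.image_empty]
  choose s hs using hatom
  have hinj : Function.Injective s := fun i j h =>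
    atomPoint_injective (φ.injective (by rw [hs, hs, h]))
  refine ⟨Equiv.ofBijective s (Finite.injective_iff_bijective.1 hinj), fun w i => ?_⟩
  -- the number of common variables is `1` or `0`
  have hmem : ∀ (w : K n) i, i ∈ w.val ↔ (w.val ∩ (atomPoint i).val).card = 1 := fun w i => by
    rw [val_atomPoint]
    by_cases hi : i ∈ w.val
    · simp [hi, Finset.inter_singleton_of_mem]
    · simp [hi, Finset.inter_singleton_of_notMem]
  rw [hmem w i, ← card_val_inter_orderIso φ, hs, ← hmem]
  rfl

end Bellissima

/-! ### Definability of the principal lower sets -/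

namespace Bellissima

variable {n : ℕ}

/-- The lower set of the points that are not above `w`. -/
def notAbove (w : K n) : Fhat n := (UpperSet.Ici w).compl

theorem mem_notAbove {u w : K n} : u ∈ notAbove w ↔ ¬ w ≤ u := by
  rw [notAbove, UpperSet.mem_compl_iff, UpperSet.mem_Ici_iff]

theorem Iio_eq_sup (w : K n) : LowerSet.Iio w = (finite_Iio w).toFinset.sup LowerSet.Iic := by
  apply SetLike.ext
  intro u
  simp only [LowerSet.mem_finsetSup_iff, Set.Finite.mem_toFinset, Set.mem_Iio, LowerSet.mem_Iio_iff,
    LowerSet.mem_Iic_iff]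
  exact ⟨fun h => ⟨u, h, le_rfl⟩, fun ⟨v, hv, huv⟩ => huv.trans_lt hv⟩

theorem notAbove_eq_himp (w : K n) : notAbove w = LowerSet.Iic w ⇨ LowerSet.Iio w := by
  apply SetLike.ext
  intro u
  simp only [mem_notAbove, LowerSet.mem_himp_iff, LowerSet.mem_Iic_iff, LowerSet.mem_Iio_iff]
  exact ⟨fun h y hyu hyw => lt_of_le_of_ne hyw (by rintro rfl; exact h hyu),
    fun h hwu => lt_irrefl w (h w hwu le_rfl)⟩

/-- The down-set of `w` is the set of points at which the variables of `val w` hold and at which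
each of the other variables, and the failure to be above any given point below `w`, implies being
strictly below `w`. -/
theorem Iic_eq_inf_himp (w : K n) : LowerSet.Iic w = w.val.inf P ⊓
    (((Finset.univ \ w.val).sup P ⊔ (finite_Iio w).toFinset.sup notAbove) ⇨ LowerSet.Iio w) := by
  set X : Fhat n := w.val.inf P ⊓
    (((Finset.univ \ w.val).sup P ⊔ (finite_Iio w).toFinset.sup notAbove) ⇨ LowerSet.Iio w) with hX
  have hmem : ∀ u, u ∈ X ↔ w.val ⊆ u.val ∧
      ∀ y ≤ u, (y.val ⊆ w.val → ∃ v < w, ¬ v ≤ y) → y < w := fun u => by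
    rw [hX, LowerSet.mem_inf_iff, LowerSet.mem_finsetInf_iff, LowerSet.mem_himp_iff]
    refine and_congr Iff.rfl (forall₂_congr fun y _ => imp_congr ?_ Iff.rfl)
    simp only [LowerSet.mem_sup_iff, LowerSet.mem_finsetSup_iff, Finset.mem_sdiff,
      Finset.mem_univ, true_and, mem_P, mem_notAbove, Set.Finite.mem_toFinset, Set.mem_Iio,
      Finset.subset_iff]
    constructor
    · rintro (⟨i, hi, hiy⟩ | h) hs
      · exact absurd (hs hiy) hi
      · exact h
    · intro h
      by_cases hs : ∀ ⦃i⦄, i ∈ y.val → i ∈ w.val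
      · exact Or.inr (h hs)
      · push Not at hs
        obtain ⟨i, hiy, hi⟩ := hs
        exact Or.inl ⟨i, hi, hiy⟩
  apply le_antisymm
  · rw [LowerSet.Iic_le, hmem]
    refine ⟨subset_rfl, fun y hy h => lt_of_le_of_ne hy ?_⟩
    rintro rfl
    obtain ⟨v, hv, hv'⟩ := h subset_rfl
    exact hv' hv.le
  · intro u hu
    change u ∈ X at hu
    change u ≤ w
    induction u using WellFoundedLT.induction with
    | _ u ih =>
      -- a minimal `u` in `X` outside `Iic w` has the valuation of `w` and lies above `Iio w`; the
      -- points strictly below it are `Iio w` or `Iic w`, and both are impossible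
      by_contra huw
      have hlt : ∀ y < u, y ≤ w := fun y hy => ih y hy (X.lower hy.le hu)
      obtain ⟨hwu, hu⟩ := (hmem u).1 hu
      have hn : ¬ (u.val ⊆ w.val → ∃ v < w, ¬ v ≤ u) := fun h => huw (hu u le_rfl h).le
      push Not at hn
      obtain ⟨huw', hbelow⟩ := hn
      have hval : u.val = w.val := subset_antisymm huw' hwu
      by_cases hwu' : w < u
      · refine val_ne_of_Iio_eq_Iic (v := w) (w := u) ?_ hval
        exact Set.Subset.antisymm hlt fun y hy => lt_of_le_of_lt hy hwu'
      · refine huw (ext_of_Iio hval (Set.Subset.antisymm (fun y hy => ?_) fun y hy => ?_)).le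
        · refine lt_of_le_of_ne (hlt y hy) ?_
          rintro rfl
          exact hwu' hy
        · refine lt_of_le_of_ne (hbelow y hy) ?_
          rintro rfl
          exact huw (le_of_lt hy)

/-- Any subalgebra that contains the sets `P i` contains all principal lower sets, by induction
along the order, carried out together with the sets `notAbove w`. -/
theorem Iic_mem_of_P_mem {L : HeytingSubalgebra (Fhat n)} (hL : ∀ i, P i ∈ L) (w : K n) :
    LowerSet.Iic w ∈ L := by
  suffices h : LowerSet.Iic w ∈ L ∧ notAbove w ∈ L from h.1
  induction w using WellFoundedLT.induction with
  | _ w ih =>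
    have hIio : LowerSet.Iio w ∈ L := by
      rw [Iio_eq_sup]
      exact L.finsetSup_mem fun v hv => (ih v (by simpa using hv)).1
    have hIic : LowerSet.Iic w ∈ L := by
      rw [Iic_eq_inf_himp]
      refine L.inf_mem' (L.finsetInf_mem fun i _ => hL i) (L.himp_mem' (L.sup_mem' ?_ ?_) hIio)
      · exact L.finsetSup_mem fun i _ => hL i
      · exact L.finsetSup_mem fun v hv => (ih v (by simpa using hv)).2
    refine ⟨hIic, ?_⟩
    rw [notAbove_eq_himp]
    exact L.himp_mem' hIic hIio

theorem exists_sem_eq_Iic (w : K n) : ∃ a, sem n a = LowerSet.Iic w := by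
  obtain ⟨a, -, ha⟩ := Iic_mem_of_P_mem (L := (⊤ : HeytingSubalgebra _).map (sem n))
    (fun i => ⟨FreeHeyting.gen i, trivial, rfl⟩) w
  exact ⟨a, ha⟩

theorem exists_sem_eq_Iio (w : K n) : ∃ a, sem n a = LowerSet.Iio w := by
  obtain ⟨a, -, ha⟩ := finite_mem_of_Iic_mem (L := (⊤ : HeytingSubalgebra _).map (sem n))
    (fun w => (exists_sem_eq_Iic w).imp fun a ha => ⟨trivial, ha⟩) (a := LowerSet.Iio w)
    (finite_Iio w)
  exact ⟨a, ha⟩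

end Bellissima

/-! ### Completeness of the generic Kripke model -/

/-- In a Heyting algebra, a prime ideal containing `a ⇨ b` contains a prime ideal that contains
`b` but not `a`. -/
theorem exists_isPrime_le_of_himp_mem {A : Type*} [HeytingAlgebra A] {I : Order.Ideal A}
    (hI : I.IsPrime) {a b : A} (h : a ⇨ b ∈ I) :
    ∃ J : Order.Ideal A, J.IsPrime ∧ J ≤ I ∧ a ∉ J ∧ b ∈ J := by
  -- the filter generated by `a` and the complement of `I`
  have hF : Order.IsPFilter {x : A | ∃ c ∉ I, c ⊓ a ≤ x} := by
    refine Order.IsPFilter.of_def ?_ ?_ ?_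
    · obtain ⟨c, hc⟩ := (Set.ne_univ_iff_exists_notMem _).1 hI.toIsProper.ne_univ
      exact ⟨c ⊓ a, c, hc, le_rfl⟩
    · rintro x ⟨c, hc, hx⟩ y ⟨d, hd, hy⟩
      refine ⟨c ⊓ d ⊓ a, ⟨c ⊓ d, fun h => (hI.mem_or_mem h).elim hc hd, le_rfl⟩, ?_, ?_⟩
      · exact (inf_le_inf_right a inf_le_left).trans hx
      · exact (inf_le_inf_right a inf_le_right).trans hy
    · rintro x y hxy ⟨c, hc, hx⟩
      exact ⟨c, hc, hx.trans hxy⟩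
  obtain ⟨J, hJ, hbJ, hdis⟩ := DistribLattice.prime_ideal_of_disjoint_filter_ideal
    (F := hF.toPFilter) (I := Order.Ideal.principal b) <| by
      rw [Set.disjoint_left]
      rintro x ⟨c, hc, hx⟩ hxb
      exact hc (I.lower (le_himp_iff.2 (hx.trans hxb)) h)
  rw [Set.disjoint_left] at hdis
  obtain ⟨c, hc⟩ := (Set.ne_univ_iff_exists_notMem _).1 hI.toIsProper.ne_univ
  refine ⟨J, hJ, fun x hx => ?_, fun ha => ?_, hbJ le_rfl⟩
  · by_contra hxI
    exact hdis ⟨x, hxI, inf_le_left⟩ hx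
  · exact hdis ⟨c, hc, inf_le_right⟩ ha

/-- The class of a formula in the free Heyting algebra. -/
def FreeHeyting.mk {α : Type*} (p : IForm α) : FreeHeyting α := Quotient.mk _ p

theorem FreeHeyting.mk_surjective {α : Type*} :
    Function.Surjective (FreeHeyting.mk : IForm α → FreeHeyting α) := Quotient.exists_rep

namespace IForm

/-- The classes, in the free Heyting algebra, of the subformulae of a formula. -/
def subclasses {α : Type*} : IForm α → Set (FreeHeyting α)
  | var a => {FreeHeyting.gen a}
  | bot => {⊥}
  | top => {⊤}
  | and p q => insert (FreeHeyting.mk (and p q)) (subclasses p ∪ subclasses q)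
  | or p q => insert (FreeHeyting.mk (or p q)) (subclasses p ∪ subclasses q)
  | imp p q => insert (FreeHeyting.mk (imp p q)) (subclasses p ∪ subclasses q)

theorem subclasses_finite {α : Type*} (p : IForm α) : (subclasses p).Finite := by
  induction p with
  | var _ | bot | top => exact Set.finite_singleton _
  | and _ _ hp hq | or _ _ hp hq | imp _ _ hp hq => exact (hp.union hq).insert _

end IForm

namespace Bellissima

variable {n : ℕ}

open FreeHeyting in
/-- The canonical Kripke model of the free Heyting algebra, filtrated through the finite set `Γ`:
its points are the traces on `Γ` of the prime ideals. A formula whose subformulae have their classes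
in `Γ` holds at a trace if and only if its class is not in the ideal. The filtrated model is finite,
so that it has a bounded morphism to the generic model. -/
theorem exists_point_of_isPrime {Γ : Set (FreeHeyting (Fin n))} (hΓ : Γ.Finite)
    {I : Order.Ideal (FreeHeyting (Fin n))} (hI : I.IsPrime) :
    ∃ w : K n, ∀ p : IForm (Fin n), p.subclasses ⊆ Γ →
      (w ∈ sem n (mk p) ↔ mk p ∉ I) := by
  classical
  let M := {U : Set (FreeHeyting (Fin n)) // ∃ I : Order.Ideal (FreeHeyting (Fin n)),
    I.IsPrime ∧ U = Γ ∩ I}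
  have hM : Finite M := by
    refine (hΓ.finite_subsets.subset ?_).to_subtype
    rintro _ ⟨I, -, rfl⟩
    exact Set.inter_subset_left
  obtain ⟨f, hval, hf⟩ := exists_boundedMorphism (M := M) (n := n) (fun m => Set.toFinite _)
    (β := fun m => {i | gen i ∉ m.1}) fun m m' h i hi => by
      simp only [Finset.mem_filter, Finset.mem_univ, true_and] at hi ⊢
      exact fun hi' => hi (h hi')
  let pt (I : Order.Ideal (FreeHeyting (Fin n))) (hI : I.IsPrime) : M := ⟨Γ ∩ I, I, hI, rfl⟩
  suffices h : ∀ p : IForm (Fin n), p.subclasses ⊆ Γ → ∀ I (hI : I.IsPrime),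
      (f (pt I hI) ∈ sem n (mk p) ↔ mk p ∉ I) from
    ⟨f (pt I hI), fun p hp => h p hp I hI⟩
  intro p
  induction p with
  | var a =>
    intro hp I hI
    change a ∈ (f (pt I hI)).val ↔ gen a ∉ I
    have ha : gen a ∈ Γ := hp rfl
    rw [hval]
    simp [pt, ha]
  | bot =>
    intro _ I hI
    exact iff_of_false (fun h => h) (fun h => h I.bot_mem)
  | top =>
    intro _ I hI
    exact iff_of_true trivial hI.toIsProper.top_notMem
  | and p q hp hq =>
    intro h I hI
    have hpΓ := hp (fun x hx => h (Or.inr (Or.inl hx))) I hI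
    have hqΓ := hq (fun x hx => h (Or.inr (Or.inr hx))) I hI
    change f (pt I hI) ∈ sem n (mk p) ∧ f (pt I hI) ∈ sem n (mk q) ↔
      mk p ⊓ mk q ∉ I
    rw [hpΓ, hqΓ, ← not_or]
    exact not_congr ⟨fun h => h.elim (I.lower inf_le_left) (I.lower inf_le_right), hI.mem_or_mem⟩
  | or p q hp hq =>
    intro h I hI
    have hpΓ := hp (fun x hx => h (Or.inr (Or.inl hx))) I hI
    have hqΓ := hq (fun x hx => h (Or.inr (Or.inr hx))) I hI
    change f (pt I hI) ∈ sem n (mk p) ∨ f (pt I hI) ∈ sem n (mk q) ↔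
      mk p ⊔ mk q ∉ I
    rw [hpΓ, hqΓ, ← not_and_or, Order.Ideal.sup_mem_iff]
  | imp p q hp hq =>
    intro h I hI
    have hpΓ := hp (fun x hx => h (Or.inr (Or.inl hx)))
    have hqΓ := hq (fun x hx => h (Or.inr (Or.inr hx)))
    have hi : mk p ⇨ mk q ∈ Γ := h (Or.inl rfl)
    change f (pt I hI) ∈ sem n (mk p ⇨ mk q) ↔ mk p ⇨ mk q ∉ I
    rw [map_himp, LowerSet.mem_himp_iff]
    constructor
    · intro hk hpq
      obtain ⟨J, hJ, hJI, hpJ, hqJ⟩ := exists_isPrime_le_of_himp_mem hI hpq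
      have hle : pt J hJ ≤ pt I hI := fun x hx => ⟨hx.1, hJI hx.2⟩
      exact (hqΓ J hJ).1 (hk (f (pt J hJ)) ((hf _).subset (Set.mem_image_of_mem f hle))
        ((hpΓ J hJ).2 hpJ)) hqJ
    · intro hpq k hk hkp
      obtain ⟨⟨_, J, hJ, rfl⟩, hm, rfl⟩ := (hf (pt I hI)).superset hk
      refine (hqΓ J hJ).2 fun hqJ => ?_
      rcases hJ.mem_or_mem (J.lower (inf_himp_le (a := mk p)) hqJ) with h | h
      · exact (hpΓ J hJ).1 hkp h
      · exact hpq (hm ⟨hi, h⟩).2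

/-- Completeness: an entailment that holds throughout the generic Kripke model is derivable. -/
theorem sem_le_iff {a b : FreeHeyting (Fin n)} : sem n a ≤ sem n b ↔ a ≤ b := by
  refine ⟨fun h => ?_, fun h => OrderHomClass.mono (sem n) h⟩
  by_contra hab
  obtain ⟨I, hI, hbI, hdis⟩ := DistribLattice.prime_ideal_of_disjoint_filter_ideal
    (F := Order.PFilter.principal a) (I := Order.Ideal.principal b) <| by
      rw [Set.disjoint_left]
      exact fun x hx hxb => hab (le_trans hx hxb)
  have haI : a ∉ I := Set.disjoint_left.1 hdis (Order.PFilter.mem_principal.2 le_rfl)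
  have hbI : b ∈ I := hbI (Order.Ideal.mem_principal.2 le_rfl)
  obtain ⟨p, rfl⟩ := FreeHeyting.mk_surjective a
  obtain ⟨q, rfl⟩ := FreeHeyting.mk_surjective b
  obtain ⟨w, hw⟩ := exists_point_of_isPrime (p.subclasses_finite.union q.subclasses_finite) hI
  exact (hw q Set.subset_union_right).1 (h ((hw p Set.subset_union_left).2 haI)) hbI

/-- The free Heyting algebra over `n` generators, embedded in the algebra of lower sets. -/
noncomputable def semEmbedding (n : ℕ) : FreeHeyting (Fin n) ↪o Fhat n :=
  OrderEmbedding.ofMapLEIff (sem n) fun _ _ => sem_le_iff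

/-! ### Automorphisms of algebras of lower sets -/

/-- An automorphism of a Heyting algebra of lower sets of the generic model that contains all
`Iic w` and `Iio w` comes from a permutation of the variables. -/
theorem exists_actsBy_of_joinDense {H : Type*} [HeytingAlgebra H] (e : H ↪o Fhat n)
    (hIic : ∀ w, ∃ h, e h = LowerSet.Iic w) (hIio : ∀ w, ∃ h, e h = LowerSet.Iio w)
    (α : HeytingAut H) :
    ∃ (σ : Equiv.Perm (Fin n)) (φ : K n ≃o K n), ActsBy φ σ ∧
      ∀ h, e (α h) = LowerSet.map φ (e h) := by
  obtain ⟨φ, hφ⟩ := exists_orderIso_of_joinDense e hIic hIio α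
  obtain ⟨σ, hσ⟩ := exists_actsBy φ
  exact ⟨σ, φ, hσ, hφ⟩

/-- Automorphisms of `H` are induced by automorphisms of the poset `K n`, that is, by permutations of
the variables; conversely every permutation acts on `Fhat n`, and on `H` if `H` is invariant. -/
theorem exists_monoidHom_of_dense {H : HeytingSubalgebra (Fhat n)}
    (hH : Dense (H : Set (Fhat n))) :
    ∃ (hmem : ∀ i, preGen i ∈ H) (ρ : HeytingAut H →* Equiv.Perm (Fin n)),
      Function.Injective ρ ∧
      (∀ (α : HeytingAut H) (i : Fin n), α ⟨preGen i, hmem i⟩ =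
        ⟨preGen (ρ α i), hmem (ρ α i)⟩) ∧
      (AutInvariant H → Function.Surjective ρ) := by
  have hmem : ∀ i, preGen i ∈ H := fun i => by
    rw [preGen_eq_Iic]
    exact Iic_mem_of_dense hH _
  choose σ φ hφσ hφ using exists_actsBy_of_joinDense H.orderEmbedding
    (fun w => ⟨⟨_, Iic_mem_of_dense hH w⟩, rfl⟩) (fun w => ⟨⟨_, Iio_mem_of_dense hH w⟩, rfl⟩)
  have hσ : ∀ (α : HeytingAut H) i, α ⟨preGen i, hmem i⟩ = ⟨preGen (σ α i), hmem (σ α i)⟩ :=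
    fun α i => Subtype.ext ((hφ α ⟨preGen i, hmem i⟩).trans ((hφσ α).map_preGen i))
  have hσ_unique : ∀ (α : HeytingAut H) i j, (α ⟨preGen i, hmem i⟩ : Fhat n) = preGen j →
      σ α i = j := fun α i j h => preGen_injective (by rw [← h, hσ])
  refine ⟨hmem, MonoidHom.mk' σ fun α β => Equiv.ext fun i => hσ_unique _ _ _ ?_, ?_, hσ, ?_⟩
  · change (α (β _) : Fhat n) = _
    rw [hσ β, hσ α]
    rfl
  · intro α β h
    have hφ' : φ α = φ β := (hφσ α).unique ((show σ α = σ β from h) ▸ hφσ β)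
    ext1
    funext h
    apply H.orderEmbedding.injective
    rw [hφ, hφ, hφ']
  · intro hinv τ
    obtain ⟨ψ, hψ⟩ := exists_orderIso_actsBy τ
    have hiff : ∀ a, a ∈ H ↔ LowerSet.map ψ a ∈ H := fun a => by
      have := hinv (LowerSet.map ψ)
      rw [← SetLike.mem_coe, ← SetLike.mem_coe]
      conv_rhs => rw [← this]
      exact ((LowerSet.map ψ).injective.mem_set_image).symm
    let α : HeytingAut H :=
      { toEquiv := (LowerSet.map ψ).toEquiv.subtypeEquiv hiff
        map_rel_iff' := fun {a b} => (LowerSet.map ψ).le_iff_le (x := a.1) (y := b.1) }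
    exact ⟨α, Equiv.ext fun i => hσ_unique α i _ (hψ.map_preGen i)⟩

end Bellissima

/-! ### Free generators -/

namespace FreeHeyting

variable {n : ℕ}

/-- A bijective homomorphism is an isomorphism. -/
theorem exists_orderIso_of_bijective {A B : Type*} [HeytingAlgebra A] [HeytingAlgebra B]
    (f : HeytingHom A B) (hf : Function.Bijective f) : ∃ e : A ≃o B, ∀ a, e a = f a := by
  refine ⟨⟨Equiv.ofBijective f hf, fun {a b} => ⟨fun h => ?_, fun h => OrderHomClass.mono f h⟩⟩,
    fun _ => rfl⟩
  have h : f a ≤ f b := h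
  rw [← inf_eq_left] at h ⊢
  exact hf.1 (by rw [map_inf, h])

/-- Renaming the variables. -/
theorem lift_gen_comp_bijective {α β : Type*} (k : α ≃ β) :
    Function.Bijective (lift (fun a => gen (k a)) : FreeHeyting α → FreeHeyting β) := by
  have h₁ : (lift fun b => gen (k.symm b)).comp (lift fun a => gen (k a)) = HeytingHom.id _ :=
    hom_ext fun a => by simp [lift_gen]
  have h₂ : (lift fun a => gen (k a)).comp (lift fun b => gen (k.symm b)) = HeytingHom.id _ :=
    hom_ext fun a => by simp [lift_gen]
  exact ⟨Function.LeftInverse.injective (DFunLike.congr_fun h₁),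
    Function.RightInverse.surjective (DFunLike.congr_fun h₂)⟩

theorem gen_injective : Function.Injective (gen : Fin n → FreeHeyting (Fin n)) := fun i j h => by
  have : (Bellissima.P i : Bellissima.Fhat n) = Bellissima.P j := congrArg (Bellissima.sem n) h
  have hi : Bellissima.atomPoint i ∈ Bellissima.P i := by
    rw [Bellissima.mem_P, Bellissima.val_atomPoint]
    exact Finset.mem_singleton_self i
  rw [this, Bellissima.mem_P, Bellissima.val_atomPoint, Finset.mem_singleton] at hi
  exact hi.symm

/-- By completeness the free algebra is an algebra of lower sets of the generic Kripke model, so its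
automorphisms come from automorphisms of that model, and these permute the sets `P i`. -/
theorem aut_gen (α : HeytingAut (FreeHeyting (Fin n))) :
    ∃ σ : Equiv.Perm (Fin n), ∀ i, α (gen i) = gen (σ i) := by
  obtain ⟨σ, φ, hφ, h⟩ := Bellissima.exists_actsBy_of_joinDense (Bellissima.semEmbedding n)
    Bellissima.exists_sem_eq_Iic Bellissima.exists_sem_eq_Iio α
  refine ⟨σ, fun i => (Bellissima.semEmbedding n).injective ?_⟩
  rw [h]
  exact hφ.map_P i

theorem exists_mulEquiv_perm : ∃ e : HeytingAut (FreeHeyting (Fin n)) ≃* Equiv.Perm (Fin n),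
    ∀ α i, α (gen i) = gen (e α i) := by
  choose σ hσ using aut_gen (n := n)
  refine ⟨MulEquiv.ofBijective (MonoidHom.mk' σ fun α β => Equiv.ext fun i => gen_injective ?_)
    ⟨fun α β h => ?_, fun τ => ?_⟩, hσ⟩
  · rw [← hσ]
    change α (β (gen i)) = gen (σ α (σ β i))
    rw [hσ, hσ]
  · have h : σ α = σ β := h
    have : (α : HeytingHom (FreeHeyting (Fin n)) (FreeHeyting (Fin n))) = β :=
      hom_ext fun i => by
        change α (gen i) = β (gen i)
        rw [hσ, hσ, h]
    ext1
    funext x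
    exact DFunLike.congr_fun this x
  · obtain ⟨α, hα⟩ := exists_orderIso_of_bijective _ (lift_gen_comp_bijective τ)
    exact ⟨α, Equiv.ext fun i => gen_injective ((hσ α i).symm.trans (hα (gen i)))⟩

/-- A set of free generators has `n` elements, because the homomorphisms to the two-element algebra
correspond to the maps from the generators to it. -/
theorem nonempty_equiv_of_isFreeGeneratingSet {S : Set (FreeHeyting (Fin n))}
    (hS : IsFreeGeneratingSet S) : Nonempty (Fin n ≃ S) := by
  obtain ⟨e, he⟩ := exists_orderIso_of_bijective _ hS
  have hbij : Function.Bijective fun (v : Fin n → Prop) (s : S) => lift v s.1 := by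
    constructor
    · intro v v' h
      have hcomp : (lift v).comp (lift (Subtype.val : S → _)) =
          (lift v').comp (lift (Subtype.val : S → _)) := hom_ext fun s => congrFun h s
      funext i
      obtain ⟨x, hx⟩ := hS.2 (gen i)
      have := DFunLike.congr_fun hcomp x
      rw [HeytingHom.comp_apply, HeytingHom.comp_apply, hx] at this
      exact this
    · intro u
      let g : HeytingHom (FreeHeyting (Fin n)) Prop :=
        (lift u).comp (e.symm : HeytingHom (FreeHeyting (Fin n)) (FreeHeyting S))
      have hg : lift (fun i => g (gen i)) = g := hom_ext fun i => rfl
      refine ⟨fun i => g (gen i), funext fun s => ?_⟩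
      change lift (fun i => g (gen i)) s.1 = u s
      rw [hg]
      change lift u (e.symm s.1) = u s
      have : e.symm s.1 = gen s := by rw [e.symm_apply_eq, he]; rfl
      rw [this]
      rfl
  have hfin : Finite (S → Prop) := Finite.of_surjective _ hbij.2
  have : Finite S := Finite.of_injective (fun s t : S => t = s) fun s t h =>
    (congrFun h s).mp rfl
  have hcard := Nat.card_congr (Equiv.ofBijective _ hbij)
  rw [Nat.card_fun, Nat.card_fun, Nat.card_eq_fintype_card (α := Prop), Fintype.card_prop] at hcard
  exact (Finite.card_eq.1 (Nat.pow_right_injective le_rfl hcard))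

/-- A bijection from the variables to a set of free generators extends to an automorphism, which only
permutes the standard generators. -/
theorem isFreeGeneratingSet_iff_eq_range (S : Set (FreeHeyting (Fin n))) :
    IsFreeGeneratingSet S ↔ S = Set.range (gen : Fin n → FreeHeyting (Fin n)) := by
  constructor
  · intro hS
    obtain ⟨k⟩ := nonempty_equiv_of_isFreeGeneratingSet hS
    obtain ⟨α, hα⟩ := exists_orderIso_of_bijective
      ((lift (Subtype.val : S → _)).comp (lift fun i => gen (k i)))
      (hS.comp (lift_gen_comp_bijective k))
    obtain ⟨σ, hσ⟩ := aut_gen α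
    have hk : ∀ i, (k i : FreeHeyting (Fin n)) = gen (σ i) := fun i =>
      ((hα (gen i)).symm.trans (hσ i) :)
    ext x
    constructor
    · intro hx
      refine ⟨σ (k.symm ⟨x, hx⟩), ?_⟩
      rw [← hk, k.apply_symm_apply]
    · rintro ⟨i, rfl⟩
      rw [← σ.apply_symm_apply i, ← hk]
      exact (k _).2
  · rintro rfl
    let k := Equiv.ofInjective _ (gen_injective (n := n))
    have hid : (lift (Subtype.val : Set.range (gen : Fin n → _) → _)).comp
        (lift fun i => gen (k i)) = HeytingHom.id _ := hom_ext fun i => rfl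
    refine (Function.Bijective.of_comp_iff _ (lift_gen_comp_bijective k)).1 ?_
    have : (lift (Subtype.val : Set.range (gen : Fin n → _) → _)) ∘ (lift fun i => gen (k i)) = id :=
      funext (DFunLike.congr_fun hid)
    exact this ▸ Function.bijective_id

end FreeHeyting

/-! ### The algebra generated by the completely join-irreducible elements -/

namespace Bellissima

variable {n : ℕ}

/-- The completely join-irreducible elements of the free algebra are the formulae that define the
sets `Iic w`. -/
theorem coe_Fkl : (Fkl n : Set (Fhat n)) =
    HeytingSubalgebra.closure (Set.range (LowerSet.Iic : K n → Fhat n)) := by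
  rw [Fkl, HeytingSubalgebra.coe_map_closure]
  congr 2
  have hcji := fun a : FreeHeyting (Fin n) => completelyJoinIrreducible_iff (a := a)
    (semEmbedding n) exists_sem_eq_Iic exists_sem_eq_Iio
  ext x
  constructor
  · rintro ⟨a, ha, rfl⟩
    obtain ⟨w, hw⟩ := (hcji a).1 ha
    exact ⟨w, hw.symm⟩
  · rintro ⟨w, rfl⟩
    obtain ⟨a, ha⟩ := exists_sem_eq_Iic w
    exact ⟨a, (hcji a).2 ⟨w, ha⟩, ha⟩

theorem dense_Fkl : Dense (Fkl n : Set (Fhat n)) := by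
  rw [coe_Fkl]
  exact dense_of_Iic_mem fun w => HeytingSubalgebra.subset_closure _ ⟨w, rfl⟩

/-- An automorphism of `Fhat n` permutes the `Iic w`, which generate `Fkl n`. -/
theorem autInvariant_Fkl : AutInvariant (Fkl n) := by
  intro ψ
  obtain ⟨φ, hφ⟩ := exists_orderIso_of_joinDense (RelEmbedding.refl _ : Fhat n ↪o Fhat n)
    (fun w => ⟨_, rfl⟩) (fun w => ⟨_, rfl⟩) ψ
  have hmap : ((Fkl n).map (ψ : HeytingHom (Fhat n) (Fhat n)) : Set (Fhat n)) =
      ψ '' (Fkl n : Set (Fhat n)) := rfl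
  have himg : ψ '' Set.range (LowerSet.Iic : K n → Fhat n) = Set.range LowerSet.Iic := by
    have hψ : ∀ w, ψ (LowerSet.Iic w) = LowerSet.Iic (φ w) := fun w =>
      (hφ _).trans (LowerSet.map_Iic φ w)
    rw [← Set.range_comp]
    ext x
    constructor
    · rintro ⟨w, rfl⟩
      exact ⟨φ w, (hψ w).symm⟩
    · rintro ⟨w, rfl⟩
      exact ⟨φ.symm w, (hψ _).trans (by rw [φ.apply_symm_apply])⟩
  have := HeytingSubalgebra.coe_map_closure (ψ : HeytingHom (Fhat n) (Fhat n))
    (Set.range (LowerSet.Iic : K n → Fhat n))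
  rw [coe_Fkl]
  refine Eq.trans this ?_
  congr 2

end Bellissima

theorem mainTheorem5 (n : ℕ) (hn : 0 < n) :
    -- the free Heyting algebra over `n` generators has exactly one set of free generators
    (∀ S : Set (FreeHeyting (Fin n)),
      IsFreeGeneratingSet S ↔ S = Set.range (FreeHeyting.gen : Fin n → FreeHeyting (Fin n))) ∧
    -- its automorphism group is `Sym(n)`, acting on the free generators
    (∃ e : HeytingAut (FreeHeyting (Fin n)) ≃* Equiv.Perm (Fin n),
      ∀ α i, α (FreeHeyting.gen i) = FreeHeyting.gen (e α i)) ∧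
    -- for dense `H`, the group `Aut(H)` embeds into `Sym(n)` (by its action on the
    -- pre-generators), and the embedding is onto if `H` is invariant
    (∀ H : HeytingSubalgebra (Bellissima.Fhat n), Dense (H : Set (Bellissima.Fhat n)) →
      ∃ (hmem : ∀ i, Bellissima.preGen i ∈ H) (ρ : HeytingAut H →* Equiv.Perm (Fin n)),
        Function.Injective ρ ∧
        (∀ (α : HeytingAut H) (i : Fin n), α ⟨Bellissima.preGen i, hmem i⟩ =
          ⟨Bellissima.preGen (ρ α i), hmem (ρ α i)⟩) ∧
        (Bellissima.AutInvariant H → Function.Surjective ρ)) ∧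
    -- the whole algebra and the algebra generated by the completely join-irreducible elements
    -- are dense and invariant
    (Dense ((⊤ : HeytingSubalgebra (Bellissima.Fhat n)) : Set (Bellissima.Fhat n)) ∧
      Bellissima.AutInvariant (⊤ : HeytingSubalgebra (Bellissima.Fhat n))) ∧
    (Dense (Bellissima.Fkl n : Set (Bellissima.Fhat n)) ∧
      Bellissima.AutInvariant (Bellissima.Fkl n)) :=
  ⟨FreeHeyting.isFreeGeneratingSet_iff_eq_range, FreeHeyting.exists_mulEquiv_perm,
    fun _ hH => Bellissima.exists_monoidHom_of_dense hH,
    ⟨dense_univ, fun φ => Set.image_univ_of_surjective φ.surjective⟩,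
    Bellissima.dense_Fkl, Bellissima.autInvariant_Fkl⟩
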